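/- Manifolds are smooth ($C^\infty$), without boundary, Hausdorff, second countable and of (constant) finite dimension. Let $X_\bullet$ be a simplicial manifold, i.e. a contravariant functor from the simplex category $\Delta$ to the category of smooth manifolds and smooth maps, with face maps $d_i\colon X_n\to X_{n-1}$ and degeneracy maps $s_i\colon X_n\to X_{n+1}$, and regard $X_0$ as a subset of $X_n$ via the iterated degeneracy map $(s_0)^n\colon X_0\to X_n$. Then there exist open subsets $U_n\subseteq X_n$ with $X_0\subseteq U_n$, $n\in\mathbb N_0$, such that $d_i(U_n)\subseteq U_{n-1}$ for all $n\ge 1$ and $0\le i\le n$, and such that the resulting semisimplicial manifold $U_\bullet$ has the following property. For $n\ge 1$ and $I\subseteq\{0,\dots,n\}$ let $$\textstyle\bigwedge^n_I(U)=\Big\{(x^j)_{j\in\{0,\dots,n\}\setminus I}\in U_{n-1}^{\{0,\dots,n\}\setminus I}\ \Big|\ d_{j_1}(x^{j_2})=d_{j_2-1}(x^{j_1})\text{ for all } j_1<j_2 \text{ in } \{0,\dots,n\}\setminus I\Big\}$$ (no condition is imposed when $n=1$), let $\bigwedge^n_i(U)=\bigwedge^n_{\{i\}}(U)$, and let $p^n_I\colon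 U_n\to\bigwedge^n_I(U)$, $x\mapsto (d_j x)_{j\notin I}$, be the horn projection. Then: (i) for all $n\ge 1$ and $0\le i\le n$, the set $\bigwedge^n_i(U)$ is an embedded submanifold of $U_{n-1}^{\times n}$, and $p^n_i\colon U_n\to\bigwedge^n_i(U)$ is a submersion; (ii) for all $1\le m<n$ and $0\le i\le m$, the set $\bigwedge^n_{\{i,m+1,\dots,n\}}(U)$ is an embedded submanifold of $U_{n-1}^{\times m}$, and $p^n_{\{i,m+1,\dots,n\}}\colon U_n\to\bigwedge^n_{\{i,m+1,\dots,n\}}(U)$ is a submersion. -/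

import Mathlib

open CategoryTheory Opposite TopologicalSpace
open scoped Manifold ContDiff Simplicial

universe u

noncomputable section

/-- A smooth manifold: a Hausdorff, second countable space with a smooth (C^∞) atlas modelled on a
finite-dimensional real vector space (without boundary). -/
structure SmoothMfd : Type (u + 1) where
  carrier : Type u
  model : Type
  [normedAddCommGroup : NormedAddCommGroup model]
  [normedSpace : NormedSpace ℝ model]
  [finiteDimensional : FiniteDimensional ℝ model]
  [topologicalSpace : TopologicalSpace carrier]
  [chartedSpace : ChartedSpace model carrier]
  [isManifold : IsManifold 𝓘(ℝ, model) ∞ carrier]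
  [t2Space : T2Space carrier]
  [secondCountable : SecondCountableTopology carrier]

namespace SmoothMfd

instance : CoeSort SmoothMfd.{u} (Type u) := ⟨SmoothMfd.carrier⟩

attribute [instance] normedAddCommGroup normedSpace finiteDimensional topologicalSpace chartedSpace
  isManifold t2Space secondCountable

/-- The category of smooth manifolds and smooth maps. -/
instance : Category SmoothMfd.{u} where
  Hom M N := C^∞⟮𝓘(ℝ, M.model), M; 𝓘(ℝ, N.model), N⟯
  id _ := ContMDiffMap.id
  comp f g := ContMDiffMap.comp g f

instance : ConcreteCategory SmoothMfd.{u}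
    (fun M N => C^∞⟮𝓘(ℝ, M.model), M; 𝓘(ℝ, N.model), N⟯) where
  hom f := f
  ofHom f := f

/-- An open subset of a smooth manifold, as a smooth manifold. -/
def ofOpens (M : SmoothMfd.{u}) (U : Opens M) : SmoothMfd.{u} where
  carrier := U
  model := M.model

/-- The restriction of a smooth map to open subsets of the source and of the target. -/
def restrictOpens {M N : SmoothMfd.{u}} (f : M ⟶ N) {U : Opens M} {V : Opens N}
    (h : Set.MapsTo f U V) : M.ofOpens U ⟶ N.ofOpens V :=
  let g : C^∞⟮𝓘(ℝ, M.model), U; 𝓘(ℝ, N.model), V⟯ :=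
    ⟨fun x => ⟨f x.1, h x.2⟩,
      (ContMDiff.iff_comp_isImmersion (Manifold.IsImmersion.of_opens V)).2
        ⟨(f.contMDiff.continuous.comp continuous_subtype_val).subtype_mk _,
          f.contMDiff.comp contMDiff_subtype_val⟩⟩
  g

end SmoothMfd

/-- A semisimplicial manifold, described by its levels, its face maps and the identities
`d_i d_{j+1} = d_j d_i` for `i ≤ j` between them. -/
structure SemisimplicialMfd : Type (u + 1) where
  obj : ℕ → SmoothMfd.{u}
  d : ∀ {n : ℕ}, Fin (n + 2) → (obj (n + 1) ⟶ obj n)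
  d_comp_d : ∀ {n : ℕ} {i j : Fin (n + 2)}, i ≤ j →
    d j.succ ≫ d i = d i.castSucc ≫ d j

namespace SemisimplicialMfd

variable (U : SemisimplicialMfd.{u})

/-- The compatibility condition for a tuple `(x^j)_{j ∉ I}` of elements of `U_n` to form an
`(n+1, I)`-horn: `d_{j₁} x^{j₂} = d_{j₂ - 1} x^{j₁}` for all `j₁ < j₂` not in `I`
(here `j₁ = i`, `j₂ = j + 1` with `i ≤ j`). For `n = 0` there is no condition. -/
def HornCompatible (n : ℕ) (I : Finset (Fin (n + 2))) (x : {j // j ∉ I} → U.obj n) : Prop :=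
  match n, I, x with
  | 0, _, _ => True
  | n + 1, I, x => ∀ (i j : Fin (n + 2)) (hi : i.castSucc ∉ I) (hj : j.succ ∉ I), i ≤ j →
      (U.d i : U.obj (n + 1) ⟶ U.obj n) (x ⟨j.succ, hj⟩) =
        (U.d j : U.obj (n + 1) ⟶ U.obj n) (x ⟨i.castSucc, hi⟩)

/-- The `(n+1, I)`-horn space, as a subset of the product of copies of `U_n` indexed by the
complement of `I` in `{0, …, n+1}`. -/
def hornSpace (n : ℕ) (I : Finset (Fin (n + 2))) : Set ({j // j ∉ I} → U.obj n) :=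
  {x | U.HornCompatible n I x}

theorem hornCompatible_faces (n : ℕ) (I : Finset (Fin (n + 2))) (x : U.obj (n + 1)) :
    U.HornCompatible n I (fun j => (U.d j.1 : U.obj (n + 1) ⟶ U.obj n) x) := by
  cases n with
  | zero => trivial
  | succ n =>
    intro i j _ _ hij
    exact congrArg (fun f : U.obj (n + 2) ⟶ U.obj n => f x) (U.d_comp_d hij)

/-- The `(n+1, I)`-horn projection `U_{n+1} → ⋀^{n+1}_I(U)`, `x ↦ (d_j x)_{j ∉ I}`. -/
def hornProj (n : ℕ) (I : Finset (Fin (n + 2))) (x : U.obj (n + 1)) : U.hornSpace n I :=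
  ⟨fun j => (U.d j.1 : U.obj (n + 1) ⟶ U.obj n) x, U.hornCompatible_faces n I x⟩

/-- The generalized Kan condition `Kan(n+1, I)` with respect to submersions: the horn space is an
embedded submanifold of the product of copies of `U_n` (it carries, on its subspace topology, a
smooth structure for which the inclusion is a smooth embedding), and for this structure the horn
projection is a submersion. -/
def Kan (n : ℕ) (I : Finset (Fin (n + 2))) : Prop :=
  ∃ (E : Type) (_ : NormedAddCommGroup E) (_ : NormedSpace ℝ E) (_ : FiniteDimensional ℝ E)
    (_ : ChartedSpace E (U.hornSpace n I)),
    IsManifold 𝓘(ℝ, E) ∞ (U.hornSpace n I) ∧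
    Manifold.IsSmoothEmbedding 𝓘(ℝ, E)
      (ModelWithCorners.pi fun _ : {j // j ∉ I} => 𝓘(ℝ, (U.obj n).model)) ∞
      (Subtype.val : U.hornSpace n I → {j // j ∉ I} → U.obj n) ∧
    Manifold.IsSubmersion 𝓘(ℝ, (U.obj (n + 1)).model) 𝓘(ℝ, E) ∞ (U.hornProj n I)

/-- Kan semisimplicial manifolds: the conditions `Kan(n, {i})` for `0 ≤ i ≤ n`, `n ≥ 1`, and
`Kan(n, {i, m+1, …, n})` for `0 ≤ i ≤ m`, `1 ≤ m < n` (written below with `n + 1` in place of `n`). -/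
structure IsKan : Prop where
  kan : ∀ (n : ℕ) (i : Fin (n + 2)), U.Kan n {i}
  kan_generalized : ∀ (n m : ℕ) (i : Fin (n + 2)), 1 ≤ m → m < n + 1 → (i : ℕ) ≤ m →
    U.Kan n (insert i (Finset.univ.filter fun j : Fin (n + 2) => m < (j : ℕ)))

end SemisimplicialMfd

/-- The embedding `X_0 → X_n` of the base space, induced by the unique map `[n] → [0]`
(equal to the iterated degeneracy `s_0 ∘ ⋯ ∘ s_0`). -/
def baseInclusion (X : SimplicialObject SmoothMfd.{u}) (n : ℕ) : X _⦋0⦌ ⟶ X _⦋n⦌ :=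
  X.map (SimplexCategory.const ⦋n⦌ ⦋0⦌ 0).op

/-- Open subsets `U_n ⊆ X_n` that are mapped to each other by the face maps of the simplicial
manifold `X` form a semisimplicial manifold. -/
def SemisimplicialMfd.ofFaceStable (X : SimplicialObject SmoothMfd.{u})
    (U : ∀ n : ℕ, Opens (X _⦋n⦌))
    (hU : ∀ (n : ℕ) (i : Fin (n + 2)), Set.MapsTo (X.δ i) (U (n + 1)) (U n)) :
    SemisimplicialMfd.{u} where
  obj n := (X _⦋n⦌).ofOpens (U n)
  d {n} i := SmoothMfd.restrictOpens (X.δ i) (hU n i)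
  d_comp_d {n i j} hij := by
    apply ContMDiffMap.ext
    intro x
    apply Subtype.ext
    exact congrArg (fun f : X _⦋n + 2⦌ ⟶ X _⦋n⦌ => f x.1) (X.δ_comp_δ hij)

end

/-! The statement is infinitesimal along the base. At a base point `p` every face and degeneracy map
preserves base points, so the tangent spaces form a simplicial vector space. There every horn has a
filler, obtained by correcting one face at a time with a degeneracy
(`SimplicialSpace.exists_filler`). Hence, for every nonempty proper `I`, the derivative of the horn
projection followed by the derivative of the compatibility equations is exact in the middle.

Exactness at one point suffices locally (`exists_slice_of_exact`): near the constant tuple at `p`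
the horn space is a submanifold onto which the horn projection submerses. Its dimension does not
depend on `p`: rank-nullity along the face operators expresses the dimensions of the joint kernels
of faces through those of the levels alone (`SimplicialSpace.finrank_faceKer_eq`). So one model
space serves all base points.

These charts cover only horns near constant tuples, whereas the entries of a horn in `U` are a
priori close to different base points. Any two entries of a horn share a vertex, however, and this
forces them to be close to a single base point once the neighbourhood is small enough
(`exists_isOpen_of_common_vertices`). Finally, there are finitely many `I` at each level, so the
required neighbourhoods can be intersected and then shrunk recursively to be stable under faces. -/

noncomputable section

/-! ### Local analysis: submanifolds from exact linearizations -/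

section LocalAnalysis

variable {E F G EA EB EC : Type*}
  [NormedAddCommGroup E] [NormedSpace ℝ E] [FiniteDimensional ℝ E]
  [NormedAddCommGroup F] [NormedSpace ℝ F] [FiniteDimensional ℝ F]
  [NormedAddCommGroup G] [NormedSpace ℝ G] [FiniteDimensional ℝ G]
  [NormedAddCommGroup EA] [NormedSpace ℝ EA] [FiniteDimensional ℝ EA]
  [NormedAddCommGroup EB] [NormedSpace ℝ EB] [FiniteDimensional ℝ EB]
  [NormedAddCommGroup EC] [NormedSpace ℝ EC] [FiniteDimensional ℝ EC]

omit [FiniteDimensional ℝ F] in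
/-- The inverse function theorem for smooth maps, with a smooth inverse on the whole target. -/
theorem ContDiffOn.exists_openPartialHomeomorph {f : E → F} {s : Set E} {a : E}
    (hs : IsOpen s) (ha : a ∈ s) (hf : ContDiffOn ℝ ∞ f s) (f' : E ≃L[ℝ] F)
    (hf' : HasFDerivAt f (f' : E →L[ℝ] F) a) :
    ∃ φ : OpenPartialHomeomorph E F, ⇑φ = f ∧ a ∈ φ.source ∧ φ.source ⊆ s ∧
      ContDiffOn ℝ ∞ φ.symm φ.target := by
  have hfa : ContDiffAt ℝ ∞ f a := hf.contDiffAt (hs.mem_nhds ha)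
  let φ₀ := hfa.toOpenPartialHomeomorph f hf' (by simp)
  have hφ₀ : ⇑φ₀ = f := hfa.toOpenPartialHomeomorph_coe hf' (by simp)
  -- At `a` alone the inverse function theorem gives a smooth inverse only near `f a`. Restricting
  -- to points with invertible derivative makes the inverse smooth on the whole target.
  let O : Set E := s ∩ fderiv ℝ f ⁻¹' Set.range ((↑) : (E ≃L[ℝ] F) → E →L[ℝ] F)
  have hO : IsOpen O :=
    (hf.continuousOn_fderiv_of_isOpen hs (by simp)).isOpen_inter_preimage hs
      ContinuousLinearEquiv.isOpen
  refine ⟨φ₀.restrOpen O hO, hφ₀, ⟨hfa.mem_toOpenPartialHomeomorph_source hf' (by simp),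
    ha, f', hf'.fderiv.symm⟩, fun x hx => hx.2.1, ?_⟩
  intro y hy
  set φ := φ₀.restrOpen O hO with hφ
  have hx : φ.symm y ∈ φ.source := φ.map_target hy
  obtain ⟨e, he⟩ := hx.2.2
  have hsm : ContDiffAt ℝ ∞ f (φ.symm y) := hf.contDiffAt (hs.mem_nhds hx.2.1)
  have hd : HasFDerivAt φ (e : E →L[ℝ] F) (φ.symm y) := by
    have := (hsm.differentiableAt (by simp)).hasFDerivAt
    rw [← he] at this
    change HasFDerivAt (⇑φ₀) _ _
    rw [hφ₀]; exact this
  refine (φ.contDiffAt_symm hy hd ?_).contDiffWithinAt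
  change ContDiffAt ℝ ∞ (⇑φ₀) _
  rw [hφ₀]; exact hsm

-- A retraction onto the kernel of `T`, followed by an isomorphism of the kernel with `G`, supplies
-- the missing coordinates. This completes a submersion to a chart.
omit [FiniteDimensional ℝ E] in
theorem LinearMap.exists_prod_bijective_of_surjective (T : EA →ₗ[ℝ] E) (hT : Function.Surjective T)
    (hdim : Module.finrank ℝ E + Module.finrank ℝ G = Module.finrank ℝ EA) :
    ∃ M : EA →ₗ[ℝ] G, Function.Bijective (T.prod M) := by
  have hker : Module.finrank ℝ (LinearMap.ker T) = Module.finrank ℝ G := by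
    have h := T.finrank_range_add_finrank_ker
    rw [LinearMap.range_eq_top.2 hT, finrank_top] at h
    omega
  let e : LinearMap.ker T ≃ₗ[ℝ] G := LinearEquiv.ofFinrankEq _ _ hker
  obtain ⟨q, hq⟩ := (LinearMap.ker T).subtype.exists_leftInverse_of_injective (by simp)
  have hq' : ∀ v : LinearMap.ker T, q v = v := fun v => LinearMap.congr_fun hq v
  refine ⟨e.toLinearMap ∘ₗ q, ?_, ?_⟩
  · rw [injective_iff_map_eq_zero]
    intro v hv
    obtain ⟨h1, h2⟩ := Prod.mk.inj hv
    have h3 : q v = 0 := e.map_eq_zero_iff.1 h2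
    have h4 : q v = ⟨v, h1⟩ := hq' ⟨v, h1⟩
    rw [h3] at h4
    exact (congrArg Subtype.val h4).symm
  · rintro ⟨x, y⟩
    obtain ⟨v, rfl⟩ := hT x
    let w : LinearMap.ker T := e.symm y - q v
    refine ⟨v + w, Prod.ext ?_ ?_⟩
    · change T (v + w) = T v
      rw [map_add, show T w = 0 from w.2, add_zero]
    · change e (q (v + w)) = y
      rw [map_add, hq']
      simp [w]

/-- A linear equivalence with a product whose second component vanishes exactly on `K`. -/
theorem Submodule.exists_equiv_prod (K : Submodule ℝ EB)
    (hE : Module.finrank ℝ E = Module.finrank ℝ K)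
    (hdim : Module.finrank ℝ E + Module.finrank ℝ F = Module.finrank ℝ EB) :
    ∃ L : EB ≃ₗ[ℝ] E × F, ∀ v, (L v).2 = 0 ↔ v ∈ K := by
  obtain ⟨K', hK⟩ := K.exists_isCompl
  have hK' : Module.finrank ℝ K' = Module.finrank ℝ F := by
    have := Submodule.finrank_add_eq_of_isCompl hK
    omega
  let e₁ : K ≃ₗ[ℝ] E := LinearEquiv.ofFinrankEq _ _ hE.symm
  let e₂ : K' ≃ₗ[ℝ] F := LinearEquiv.ofFinrankEq _ _ hK'
  refine ⟨(K.prodEquivOfIsCompl K' hK).symm.trans (e₁.prodCongr e₂), fun v => ?_⟩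
  change e₂ ((K.prodEquivOfIsCompl K' hK).symm v).2 = 0 ↔ _
  rw [e₂.map_eq_zero_iff, Submodule.prodEquivOfIsCompl_symm_apply_snd_eq_zero]

omit [FiniteDimensional ℝ F] [FiniteDimensional ℝ EC] in
theorem LinearMap.exists_comp_eq_of_ker_le (g : EB →ₗ[ℝ] EC) (l : EB →ₗ[ℝ] F)
    (h : LinearMap.ker g ≤ LinearMap.ker l) : ∃ P : EC →ₗ[ℝ] F, P ∘ₗ g = l := by
  obtain ⟨s, hs⟩ := g.rangeRestrict.exists_rightInverse_of_surjective g.range_rangeRestrict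
  obtain ⟨P, hP⟩ := LinearMap.exists_extend (l ∘ₗ s)
  refine ⟨P, LinearMap.ext fun v => ?_⟩
  have h1 : P (g v) = l (s (g.rangeRestrict v)) := LinearMap.congr_fun hP (g.rangeRestrict v)
  have h2 : g (s (g.rangeRestrict v)) = g v :=
    congrArg Subtype.val (LinearMap.congr_fun hs (g.rangeRestrict v))
  have h3 : s (g.rangeRestrict v) - v ∈ LinearMap.ker l := h (by simp [h2])
  rw [LinearMap.comp_apply, h1]
  simpa [sub_eq_zero] using h3

/-- If `g ∘ f = 0` near `a` and the derivatives of `f` at `a` and of `g` at `f a` form an exact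
sequence, then near `f a` the zero set of `g` is a submanifold onto which `f` submerses. -/
theorem exists_slice_of_exact {f : EA → EB} {g : EB → EC} {OA : Set EA} {OB : Set EB} {a : EA}
    (hOA : IsOpen OA) (hOB : IsOpen OB) (ha : a ∈ OA) (hb : f a ∈ OB)
    (hf : ContDiffOn ℝ ∞ f OA) (hg : ContDiffOn ℝ ∞ g OB)
    (hgf : ∀ u ∈ OA, f u ∈ OB → g (f u) = 0)
    {f' : EA →L[ℝ] EB} {g' : EB →L[ℝ] EC} (hf' : HasFDerivAt f f' a) (hg' : HasFDerivAt g g' (f a))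
    (hexact : ∀ v, g' v = 0 → ∃ u, f' u = v)
    (hE : Module.finrank ℝ E = Module.finrank ℝ (LinearMap.range (f' : EA →ₗ[ℝ] EB)))
    (hF : Module.finrank ℝ E + Module.finrank ℝ F = Module.finrank ℝ EB)
    (hG : Module.finrank ℝ E + Module.finrank ℝ G = Module.finrank ℝ EA) :
    ∃ (φ : OpenPartialHomeomorph EB (E × F)) (χ : OpenPartialHomeomorph EA (E × G)),
      φ.source ⊆ OB ∧ χ.source ⊆ OA ∧ a ∈ χ.source ∧
      ContDiffOn ℝ ∞ φ φ.source ∧ ContDiffOn ℝ ∞ φ.symm φ.target ∧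
      ContDiffOn ℝ ∞ χ χ.source ∧ ContDiffOn ℝ ∞ χ.symm χ.target ∧
      (∀ y ∈ φ.source, g y = 0 ↔ (φ y).2 = 0) ∧
      ∀ u ∈ χ.source, f u ∈ φ.source ∧ (φ (f u)).1 = (χ u).1 := by
  set K := LinearMap.range (f' : EA →ₗ[ℝ] EB) with hKdef
  have hgf' : g'.comp f' = 0 := by
    refine (hg'.comp a hf').unique ((hasFDerivAt_const (0 : EC) a).congr_of_eventuallyEq ?_)
    filter_upwards [hOA.mem_nhds ha,
      (hf.continuousOn.continuousAt (hOA.mem_nhds ha)).preimage_mem_nhds (hOB.mem_nhds hb)]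
      with u hu hu' using hgf u hu hu'
  obtain ⟨L, hL⟩ := K.exists_equiv_prod (F := F) hE hF
  -- By exactness `ker g'` lies in `K`, the kernel of the second component of `L`. That component
  -- therefore factors through `g'`, and `P` selects combinations of the equations `g = 0` with
  -- independent differentials.
  obtain ⟨P, hP⟩ := (g' : EB →ₗ[ℝ] EC).exists_comp_eq_of_ker_le
    (LinearMap.snd ℝ E F ∘ₗ L.toLinearMap) (fun v hv => by
      have : v ∈ K := hexact v hv
      exact (hL v).2 this)
  let Lc : EB ≃L[ℝ] E × F := L.toContinuousLinearEquiv
  let Pc : EC →L[ℝ] F := LinearMap.toContinuousLinearMap P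
  let L₁ : EB →L[ℝ] E := (ContinuousLinearMap.fst ℝ E F).comp (Lc : EB →L[ℝ] E × F)
  have hPg : ∀ v, Pc (g' v) = (Lc v).2 := fun v => LinearMap.congr_fun hP v
  -- the slice chart
  let Φ : EB → E × F := fun y => (L₁ y, Pc (g y))
  have hΦ : ContDiffOn ℝ ∞ Φ OB := L₁.contDiff.contDiffOn.prodMk (Pc.contDiff.comp_contDiffOn hg)
  have hΦ' : HasFDerivAt Φ (Lc : EB →L[ℝ] E × F) (f a) := by
    have h : (Lc : EB →L[ℝ] E × F) = L₁.prod (Pc.comp g') :=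
      ContinuousLinearMap.ext fun v => Prod.ext rfl (hPg v).symm
    rw [h]
    exact L₁.hasFDerivAt.prodMk (Pc.hasFDerivAt.comp (f a) hg')
  obtain ⟨φ₁, hφ₁, hφb, hφO, hφs⟩ := hΦ.exists_openPartialHomeomorph hOB hb Lc hΦ'
  -- the adapted chart of the source
  have hT : Function.Surjective (L₁.comp f' : EA →ₗ[ℝ] E) := by
    intro e
    have : Lc.symm (e, 0) ∈ K := (hL _).1 (by
      change (Lc (Lc.symm (e, 0))).2 = 0
      simp)
    obtain ⟨u, hu⟩ := this
    refine ⟨u, ?_⟩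
    change (Lc (f' u)).1 = e
    rw [show f' u = Lc.symm (e, 0) from hu]
    simp
  obtain ⟨M, hM⟩ := LinearMap.exists_prod_bijective_of_surjective (G := G) _ hT hG
  let Mc : EA →L[ℝ] G := LinearMap.toContinuousLinearMap M
  let Q : EA ≃L[ℝ] E × G := (LinearEquiv.ofBijective _ hM).toContinuousLinearEquiv
  let OA' : Set EA := OA ∩ f ⁻¹' φ₁.source
  have hOA' : IsOpen OA' := hf.continuousOn.isOpen_inter_preimage hOA φ₁.open_source
  let Ψ : EA → E × G := fun u => (L₁ (f u), Mc u)
  have hΨ : ContDiffOn ℝ ∞ Ψ OA' :=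
    (L₁.contDiff.comp_contDiffOn (hf.mono Set.inter_subset_left)).prodMk Mc.contDiff.contDiffOn
  have hΨ' : HasFDerivAt Ψ (Q : EA →L[ℝ] E × G) a :=
    (L₁.hasFDerivAt.comp a hf').prodMk Mc.hasFDerivAt
  obtain ⟨χ₁, hχ₁, hχa, hχO, hχs⟩ := hΨ.exists_openPartialHomeomorph hOA' ⟨ha, hφb⟩ Q hΨ'
  -- shrinking both charts
  let O : Set EB := (fun y => (L₁ y, Mc a)) ⁻¹' χ₁.target
  have hO : IsOpen O := χ₁.open_target.preimage (by fun_prop)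
  have hχaT : (L₁ (f a), Mc a) ∈ χ₁.target := by
    have := χ₁.map_source hχa
    rwa [hχ₁] at this
  let φ := φ₁.restrOpen O hO
  let N : Set EA := OA' ∩ f ⁻¹' O
  have hN : IsOpen N :=
    (hf.continuousOn.mono Set.inter_subset_left).isOpen_inter_preimage hOA' hO
  let χ := χ₁.restrOpen N hN
  have hφ : ⇑φ = Φ := hφ₁
  have hχ : ⇑χ = Ψ := hχ₁
  refine ⟨φ, χ, fun y hy => hφO hy.1, fun u hu => (hχO hu.1).1, ⟨hχa, ⟨ha, hφb⟩, hχaT⟩,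
    ?_, ?_, ?_, ?_, ?_, ?_⟩
  · rw [hφ]; exact hΦ.mono fun y hy => hφO hy.1
  · exact hφs.mono fun y hy => hy.1
  · rw [hχ]; exact hΨ.mono fun y hy => hχO hy.1
  · exact hχs.mono fun y hy => hy.1
  · intro y hy
    rw [hφ]
    change g y = 0 ↔ Pc (g y) = 0
    refine ⟨fun h => by rw [h, map_zero], fun h => ?_⟩
    -- The selected equations imply the others: `L₁ ∘ f` is submersive, so some `f u` has the same
    -- `E`-coordinate as `y`. Both have vanishing `F`-coordinate, hence `y = f u`, where `g`
    -- vanishes.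
    set u := χ₁.symm (L₁ y, Mc a) with hu
    have huS : u ∈ χ₁.source := χ₁.map_target hy.2
    have huΨ : Ψ u = (L₁ y, Mc a) := by rw [← hχ₁]; exact χ₁.right_inv hy.2
    have hfu : f u ∈ φ₁.source := (hχO huS).2
    have hgu : g (f u) = 0 := hgf u (hχO huS).1 (hφO hfu)
    have : f u = y := φ₁.injOn hfu hy.1 (by
      rw [hφ₁]
      change (L₁ (f u), Pc (g (f u))) = (L₁ y, Pc (g y))
      have h₁ : L₁ (f u) = L₁ y := (Prod.mk.inj huΨ).1
      rw [hgu, h, map_zero, h₁])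
    rw [← this, hgu]
  · intro u hu
    refine ⟨⟨(hχO hu.1).2, hu.2.2⟩, ?_⟩
    rw [hφ, hχ]

end LocalAnalysis

/-! ### Simplicial vector spaces: horn filling and dimension count -/

/-- A simplicial real vector space, with face and degeneracy operators indexed by natural numbers
(only the values in the usual ranges of indices are meaningful). -/
structure SimplicialSpace where
  V : ℕ → Type
  [addCommGroup : ∀ n, AddCommGroup (V n)]
  [module : ∀ n, Module ℝ (V n)]
  d : ∀ n, ℕ → V (n + 1) →ₗ[ℝ] V n
  s : ∀ n, ℕ → V n →ₗ[ℝ] V (n + 1)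
  d_d : ∀ n i j x, i ≤ j → j ≤ n + 1 → d n i (d (n + 1) (j + 1) x) = d n j (d (n + 1) i x)
  d_s_of_le : ∀ n i j x, i ≤ j → j ≤ n → d (n + 1) i (s (n + 1) (j + 1) x) = s n j (d n i x)
  d_s_self : ∀ n i x, i ≤ n → d n i (s n i x) = x
  d_s_succ : ∀ n i x, i ≤ n → d n (i + 1) (s n i x) = x
  d_s_of_gt : ∀ n i j x, j < i → i ≤ n + 1 → d (n + 1) (i + 1) (s (n + 1) j x) = s n j (d n i x)

namespace SimplicialSpace

attribute [instance] addCommGroup module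

variable (A : SimplicialSpace)

/-- Fillers of the faces of a horn below the missing face `k`. -/
theorem exists_filler_below (n : ℕ) (J : Finset ℕ) (k : ℕ) (hk : k ≤ n + 2) (y : ℕ → A.V (n + 1))
    (hy : ∀ i j, i ∈ J → j + 1 ∈ J → i ≤ j → j ≤ n + 1 → A.d n i (y (j + 1)) = A.d n j (y i)) :
    ∀ r, r ≤ k → ∃ w, ∀ j ∈ J, j < r → A.d (n + 1) j w = y j := by
  intro r
  induction r with
  | zero => exact fun _ => ⟨0, fun j _ h => absurd h (Nat.not_lt_zero _)⟩
  | succ r ih =>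
    intro hr
    obtain ⟨w, hw⟩ := ih (by omega)
    by_cases hrJ : r ∈ J
    -- The `s r`-degeneracy of the error corrects face `r`. The earlier prescribed faces survive,
    -- since compatibility makes the corresponding faces of the error vanish.
    · refine ⟨w + A.s (n + 1) r (y r - A.d (n + 1) r w), fun j hj hjr => ?_⟩
      rw [map_add]
      rcases Nat.lt_succ_iff_lt_or_eq.1 hjr with h | rfl
      · obtain ⟨q, rfl⟩ : ∃ q, r = q + 1 := ⟨r - 1, by omega⟩
        rw [A.d_s_of_le n j q _ (by omega) (by omega), map_sub,
          hy j q hj hrJ (by omega) (by omega), A.d_d n j q w (by omega) (by omega), hw j hj h,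
          sub_self, map_zero, add_zero]
      · rw [A.d_s_self _ _ _ (by omega), add_sub_cancel]
    · refine ⟨w, fun j hj hjr => hw j hj ?_⟩
      have : j ≠ r := fun h => hrJ (h ▸ hj)
      omega

/-- Horns in simplicial vector spaces have fillers. -/
theorem exists_filler (n : ℕ) (J : Finset ℕ) (k : ℕ) (hk : k ≤ n + 2) (hkJ : k ∉ J)
    (hJ : ∀ j ∈ J, j ≤ n + 2) (y : ℕ → A.V (n + 1))
    (hy : ∀ i j, i ∈ J → j + 1 ∈ J → i ≤ j → j ≤ n + 1 → A.d n i (y (j + 1)) = A.d n j (y i)) :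
    ∃ w, ∀ j ∈ J, A.d (n + 1) j w = y j := by
  -- The faces above `k` are treated downwards from `n + 2`; after `r` steps those with index
  -- greater than `n + 2 - r` are correct.
  have key : ∀ r, ∃ w, ∀ j ∈ J, (j < k ∨ n + 2 < j + r) → A.d (n + 1) j w = y j := by
    intro r
    induction r with
    | zero =>
      obtain ⟨w, hw⟩ := A.exists_filler_below n J k hk y hy k le_rfl
      exact ⟨w, fun j hj h => hw j hj (h.resolve_right (by have := hJ j hj; omega))⟩
    | succ r ih =>
      obtain ⟨w, hw⟩ := ih
      by_cases hq : r ≤ n + 2 ∧ n + 2 - r ∈ J ∧ k < n + 2 - r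
      · obtain ⟨hr, hqJ, hkq⟩ := hq
        obtain ⟨q, hq⟩ : ∃ q, n + 2 - r = q + 1 := ⟨n + 2 - r - 1, by omega⟩
        rw [hq] at hqJ hkq
        -- Face `q + 1` is now corrected with `s q`. The faces below `k` and above `q + 1` stay
        -- correct, because the error has vanishing faces there.
        refine ⟨w + A.s (n + 1) q (y (q + 1) - A.d (n + 1) (q + 1) w), fun j hj h => ?_⟩
        rw [map_add]
        rcases lt_trichotomy j (q + 1) with hlt | rfl | hgt
        · have hjk : j < k := by omega
          obtain ⟨p, rfl⟩ : ∃ p, q = p + 1 := ⟨q - 1, by omega⟩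
          rw [A.d_s_of_le n j p _ (by omega) (by omega), map_sub,
            hy j (p + 1) hj hqJ (by omega) (by omega), A.d_d n j (p + 1) w (by omega) (by omega),
            hw j hj (Or.inl hjk), sub_self, map_zero, add_zero]
        · rw [A.d_s_succ _ _ _ (by omega), add_sub_cancel]
        · obtain ⟨i, rfl⟩ : ∃ i, j = i + 1 := ⟨j - 1, by omega⟩
          have hj' := hJ _ hj
          rw [A.d_s_of_gt n i q _ (by omega) (by omega), map_sub,
            ← hy (q + 1) i hqJ hj (by omega) (by omega),
            ← A.d_d n (q + 1) i w (by omega) (by omega),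
            hw (i + 1) hj (Or.inr (by omega)), sub_self, map_zero, add_zero]
      · refine ⟨w, fun j hj h => hw j hj ?_⟩
        rcases h with h | h
        · exact Or.inl h
        · by_contra hcon
          have hjk : j ≠ k := fun h => hkJ (h ▸ hj)
          have := hJ j hj
          exact hq ⟨by omega, by rwa [show n + 2 - r = j by omega], by omega⟩
  obtain ⟨w, hw⟩ := key (n + 3)
  exact ⟨w, fun j hj => hw j hj (Or.inr (by omega))⟩

/-- The intersection of the kernels of the face operators with index in `J`. -/
def faceKer (n : ℕ) (J : Finset ℕ) : Submodule ℝ (A.V n) :=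
  match n with
  | 0 => ⊤
  | n + 1 => ⨅ j ∈ J, LinearMap.ker (A.d n j)

theorem faceKer_empty (n : ℕ) : A.faceKer n ∅ = ⊤ := by
  cases n with
  | zero => rfl
  | succ n => simp [faceKer]

theorem mem_faceKer_succ (n : ℕ) (J : Finset ℕ) (x : A.V (n + 1)) :
    x ∈ A.faceKer (n + 1) J ↔ ∀ j ∈ J, A.d n j x = 0 := by
  simp [faceKer, Submodule.mem_iInf]

/-- Fill the horn with entry `v` at `m` and zero at the indices in `J`; it is compatible because the
faces of `v` in `J` vanish. The bound on `J.card` leaves an index free for the missing face. -/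
theorem exists_mem_faceKer_d_eq (n : ℕ) (J : Finset ℕ) (m : ℕ) (hm : m ≤ n + 1)
    (hJ : ∀ j ∈ J, j < m) (hcard : J.card ≤ n) (v : A.V n) (hv : v ∈ A.faceKer n J) :
    ∃ w ∈ A.faceKer (n + 1) J, A.d n m w = v := by
  cases n with
  | zero =>
    obtain rfl : J = ∅ := Finset.card_eq_zero.1 (Nat.le_zero.1 hcard)
    refine ⟨A.s 0 0 v, (A.mem_faceKer_succ _ _ _).2 (by simp), ?_⟩
    rcases Nat.le_one_iff_eq_zero_or_eq_one.1 hm with rfl | rfl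
    · exact A.d_s_self _ _ _ le_rfl
    · exact A.d_s_succ _ _ _ le_rfl
  | succ n =>
    rw [mem_faceKer_succ] at hv
    have hmJ : m ∉ J := fun h => lt_irrefl _ (hJ m h)
    obtain ⟨k, hk, hkJ⟩ : ∃ k ∈ Finset.range (n + 3), k ∉ insert m J := by
      apply Finset.exists_mem_notMem_of_card_lt_card
      rw [Finset.card_insert_of_notMem hmJ, Finset.card_range]
      omega
    obtain ⟨w, hw⟩ := A.exists_filler n (insert m J) k (by rw [Finset.mem_range] at hk; omega) hkJ
      (fun j hj => by
        rcases Finset.mem_insert.1 hj with rfl | h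
        · omega
        · have := hJ j h; omega)
      (fun j => if j = m then v else 0) (fun i j hi hj hij _ => by
        rcases Finset.mem_insert.1 hj with h | h
        · have hi' : i ∈ J := (Finset.mem_insert.1 hi).resolve_left (by omega)
          rw [if_pos h, if_neg (by omega), map_zero, hv i hi']
        · have := hJ _ h
          rw [if_neg (by omega), if_neg (by omega), map_zero, map_zero])
    refine ⟨w, (A.mem_faceKer_succ _ _ _).2 fun j hj => ?_, ?_⟩
    · rw [hw j (Finset.mem_insert_of_mem hj), if_neg (hJ j hj).ne]
    · rw [hw m (Finset.mem_insert_self _ _), if_pos rfl]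

variable [∀ n, FiniteDimensional ℝ (A.V n)]

/-- Rank-nullity for the operator `d m` on `faceKer (n + 1) J`. Since `J` lies below `m`, the
identity `d j ∘ d m = d (m - 1) ∘ d j` puts the image in `faceKer n J`, and horn filling makes it
all of it. -/
theorem finrank_faceKer_insert (n : ℕ) (J : Finset ℕ) (m : ℕ) (hm : m ≤ n + 1)
    (hJ : ∀ j ∈ J, j < m) (hcard : J.card ≤ n) :
    Module.finrank ℝ (A.faceKer n J) + Module.finrank ℝ (A.faceKer (n + 1) (insert m J)) =
      Module.finrank ℝ (A.faceKer (n + 1) J) := by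
  let T := (A.d n m).domRestrict (A.faceKer (n + 1) J)
  have hle : A.faceKer (n + 1) (insert m J) ≤ A.faceKer (n + 1) J := fun x hx =>
    (A.mem_faceKer_succ _ _ _).2 fun j hj =>
      (A.mem_faceKer_succ _ _ _).1 hx j (Finset.mem_insert_of_mem hj)
  have hker : LinearMap.ker T =
      (A.faceKer (n + 1) (insert m J)).comap (A.faceKer (n + 1) J).subtype := by
    ext ⟨x, hx⟩
    rw [mem_faceKer_succ] at hx
    simpa [T, mem_faceKer_succ] using fun _ => hx
  have hrange : LinearMap.range T = A.faceKer n J := by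
    ext v
    constructor
    · rintro ⟨⟨x, hx⟩, rfl⟩
      rw [mem_faceKer_succ] at hx
      cases n with
      | zero => trivial
      | succ n =>
        refine (A.mem_faceKer_succ _ _ _).2 fun j hj => ?_
        have hjm := hJ j hj
        obtain ⟨q, rfl⟩ : ∃ q, m = q + 1 := ⟨m - 1, by omega⟩
        change A.d n j (A.d (n + 1) (q + 1) x) = 0
        rw [A.d_d n j q x (by omega) (by omega), hx j hj, map_zero]
    · intro hv
      obtain ⟨w, hw, rfl⟩ := A.exists_mem_faceKer_d_eq n J m hm hJ hcard v hv
      exact ⟨⟨w, hw⟩, rfl⟩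
  have h := T.finrank_range_add_finrank_ker
  rw [hrange, hker, (Submodule.comapSubtypeEquivOfLe hle).finrank_eq] at h
  exact h

/-- The dimension of the space of simplices with prescribed vanishing faces is determined by the
dimensions of the levels. -/
theorem finrank_faceKer_eq (B : SimplicialSpace) [∀ n, FiniteDimensional ℝ (B.V n)]
    (hAB : ∀ n, Module.finrank ℝ (A.V n) = Module.finrank ℝ (B.V n)) (J : Finset ℕ) :
    ∀ n, (∀ j ∈ J, j ≤ n) → J.card ≤ n →
      Module.finrank ℝ (A.faceKer n J) = Module.finrank ℝ (B.faceKer n J) := by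
  -- Removing the largest index keeps the remaining ones below it, as rank-nullity for that face
  -- requires.
  induction J using Finset.induction_on_max with
  | empty =>
    intro n _ _
    rw [faceKer_empty, faceKer_empty, finrank_top, finrank_top, hAB]
  | insert m J hJ ih =>
    intro n hn hcard
    have hmJ : m ∉ J := fun h => lt_irrefl _ (hJ m h)
    rw [Finset.card_insert_of_notMem hmJ] at hcard
    obtain ⟨n, rfl⟩ : ∃ q, n = q + 1 := ⟨n - 1, by omega⟩
    have hm := hn m (Finset.mem_insert_self _ _)
    have hA := A.finrank_faceKer_insert n J m hm hJ (by omega)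
    have hB := B.finrank_faceKer_insert n J m hm hJ (by omega)
    have h₁ := ih n (fun j hj => by have := hJ j hj; omega) (by omega)
    have h₂ := ih (n + 1) (fun j hj => hn j (Finset.mem_insert_of_mem hj)) (by omega)
    omega

end SimplicialSpace

/-! ### Finite products of manifolds -/

section PiManifold

variable {ι : Type*} [Fintype ι] {𝕜 : Type*} [NontriviallyNormedField 𝕜]
  {E : ι → Type*} [∀ i, NormedAddCommGroup (E i)] [∀ i, NormedSpace 𝕜 (E i)]
  {H : ι → Type*} [∀ i, TopologicalSpace (H i)] {I : ∀ i, ModelWithCorners 𝕜 (E i) (H i)}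
  {n : WithTop ℕ∞}
  {M : ι → Type*} [∀ i, TopologicalSpace (M i)] [∀ i, ChartedSpace (H i) (M i)]

theorem contDiffGroupoid_pi {e : ∀ i, OpenPartialHomeomorph (H i) (H i)}
    (he : ∀ i, e i ∈ contDiffGroupoid n (I i)) :
    (OpenPartialHomeomorph.pi e : OpenPartialHomeomorph (ModelPi H) (ModelPi H)) ∈
      contDiffGroupoid n (ModelWithCorners.pi I) := by
  constructor
  · refine contDiffOn_pi.2 fun i => ?_
    refine (he i).1.comp (ContinuousLinearMap.proj (R := 𝕜) (φ := E) i).contDiff.contDiffOn ?_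
    rintro x ⟨hx, y, rfl⟩
    exact ⟨hx i trivial, y i, rfl⟩
  · refine contDiffOn_pi.2 fun i => ?_
    refine (he i).2.comp (ContinuousLinearMap.proj (R := 𝕜) (φ := E) i).contDiff.contDiffOn ?_
    rintro x ⟨hx, y, rfl⟩
    exact ⟨hx i trivial, y i, rfl⟩

-- The transition map of product charts agrees with the product of the transition maps on its
-- source, and membership in the groupoid is invariant under this relation.
omit [∀ i, ChartedSpace (H i) (M i)] in
theorem contDiffGroupoid_pi_symm_trans {e e' : ∀ i, OpenPartialHomeomorph (M i) (H i)}
    (h : ∀ i, (e i).symm.trans (e' i) ∈ contDiffGroupoid n (I i)) :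
    OpenPartialHomeomorph.trans (Z := ModelPi H)
      (OpenPartialHomeomorph.symm (Y := ModelPi H) (OpenPartialHomeomorph.pi e))
      (OpenPartialHomeomorph.pi e') ∈ contDiffGroupoid n (ModelWithCorners.pi I) := by
  refine (contDiffGroupoid n _).mem_of_eqOnSource (contDiffGroupoid_pi h) ⟨?_, fun x _ => rfl⟩
  ext x
  constructor
  · rintro ⟨h₁, h₂⟩ i hi
    exact ⟨h₁ i hi, h₂ i hi⟩
  · intro hx
    exact ⟨fun i hi => (hx i hi).1, fun i hi => (hx i hi).2⟩

instance IsManifold.pi [∀ i, IsManifold (I i) n (M i)] :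
    IsManifold (ModelWithCorners.pi I) n (∀ i, M i) where
  compatible := by
    rintro _ _ ⟨e, he, rfl⟩ ⟨e', he', rfl⟩
    exact contDiffGroupoid_pi_symm_trans fun i =>
      HasGroupoid.compatible (he i trivial) (he' i trivial)

theorem IsManifold.pi_mem_maximalAtlas {e : ∀ i, OpenPartialHomeomorph (M i) (H i)}
    (he : ∀ i, e i ∈ IsManifold.maximalAtlas (I i) n (M i)) :
    (OpenPartialHomeomorph.pi e : OpenPartialHomeomorph (∀ i, M i) (ModelPi H)) ∈
      IsManifold.maximalAtlas (ModelWithCorners.pi I) n (∀ i, M i) := by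
  rintro _ ⟨e', he', rfl⟩
  exact ⟨contDiffGroupoid_pi_symm_trans fun i => (he i _ (he' i trivial)).1,
    contDiffGroupoid_pi_symm_trans fun i => (he i _ (he' i trivial)).2⟩

instance ModelWithCorners.pi_boundaryless [∀ i, (I i).Boundaryless] :
    (ModelWithCorners.pi I).Boundaryless where
  range_eq_univ := by
    refine Set.eq_univ_of_forall fun x => ⟨fun i => (I i).symm (x i), ?_⟩
    exact funext fun i => (I i).right_inv (by simp [ModelWithCorners.Boundaryless.range_eq_univ])

end PiManifold

/-! ### Submanifolds and submersions from slice charts -/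

section Slices

variable {E F G EA EB : Type}
  [NormedAddCommGroup E] [NormedSpace ℝ E] [NormedAddCommGroup F] [NormedSpace ℝ F]
  [NormedAddCommGroup G] [NormedSpace ℝ G]
  [NormedAddCommGroup EA] [NormedSpace ℝ EA] [NormedAddCommGroup EB] [NormedSpace ℝ EB]
  {HB : Type*} [TopologicalSpace HB] {J : ModelWithCorners ℝ EB HB}
  {A : Type*} [TopologicalSpace A] [ChartedSpace EA A]
  {B : Type*} [TopologicalSpace B] [ChartedSpace HB B]

/-- A chart followed by a local diffeomorphism of the model vector space. -/
def OpenPartialHomeomorph.transModel [J.Boundaryless] (c : OpenPartialHomeomorph B HB)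
    (φ : OpenPartialHomeomorph EB E) : OpenPartialHomeomorph B E :=
  (c.trans J.toHomeomorph.toOpenPartialHomeomorph).trans φ

theorem OpenPartialHomeomorph.contMDiffOn_transModel [J.Boundaryless]
    {c : OpenPartialHomeomorph B HB} (hc : c ∈ IsManifold.maximalAtlas J ∞ B)
    {φ : OpenPartialHomeomorph EB E} (hφ : ContDiffOn ℝ ∞ φ φ.source) :
    ContMDiffOn J 𝓘(ℝ, E) ∞ (c.transModel (J := J) φ) (c.transModel (J := J) φ).source :=
  (contMDiffOn_iff_contDiffOn.2 hφ).comp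
    ((c.contMDiffOn_extend hc).mono fun _ hy => hy.1.1) fun _ hy => hy.2

theorem OpenPartialHomeomorph.contMDiffOn_transModel_symm [J.Boundaryless]
    {c : OpenPartialHomeomorph B HB} (hc : c ∈ IsManifold.maximalAtlas J ∞ B)
    {φ : OpenPartialHomeomorph EB E} (hφ : ContDiffOn ℝ ∞ φ.symm φ.target) :
    ContMDiffOn 𝓘(ℝ, E) J ∞ (c.transModel (J := J) φ).symm (c.transModel (J := J) φ).target :=
  (contMDiffOn_extend_symm hc).comp
    ((contMDiffOn_iff_contDiffOn.2 hφ).mono fun _ hy => hy.1)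
    fun _ hy => ⟨_, hy.2.2, J.right_inv (by simp [J.range_eq_univ])⟩

variable (J) in
/-- A chart with values in `E × F` in which the set `S` is given by the vanishing of the second
component. -/
structure IsSliceChart (S : Set B) (φ : OpenPartialHomeomorph B (E × F)) : Prop where
  contMDiffOn : ContMDiffOn J 𝓘(ℝ, E × F) ∞ φ φ.source
  contMDiffOn_symm : ContMDiffOn 𝓘(ℝ, E × F) J ∞ φ.symm φ.target
  mem_iff : ∀ y ∈ φ.source, y ∈ S ↔ (φ y).2 = 0

namespace IsSliceChart

variable {S : Set B} {φ φ' : OpenPartialHomeomorph B (E × F)}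

theorem apply_eq (hφ : IsSliceChart J S φ) (s : S) (hs : s.1 ∈ φ.source) :
    φ s.1 = ((φ s.1).1, 0) :=
  Prod.ext rfl ((hφ.mem_iff _ hs).1 s.2)

theorem symm_mem (hφ : IsSliceChart J S φ) {e : E} (he : (e, (0 : F)) ∈ φ.target) :
    φ.symm (e, 0) ∈ S :=
  (hφ.mem_iff _ (φ.map_target he)).2 (by rw [φ.right_inv he])

open Classical in
/-- The chart of `S` induced by a slice chart. -/
def chart (hφ : IsSliceChart J S φ) (s₀ : S) : OpenPartialHomeomorph S E where
  toFun s := (φ s.1).1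
  -- The value `s₀` is a default outside the target.
  invFun e := if h : φ.symm (e, 0) ∈ S then ⟨φ.symm (e, 0), h⟩ else s₀
  source := Subtype.val ⁻¹' φ.source
  target := (fun e => (e, (0 : F))) ⁻¹' φ.target
  map_source' s hs := by
    change ((φ s.1).1, (0 : F)) ∈ φ.target
    rw [← hφ.apply_eq s hs]
    exact φ.map_source hs
  map_target' e he := by
    change (dite _ _ _ : S).1 ∈ φ.source
    rw [dif_pos (hφ.symm_mem he)]
    exact φ.map_target he
  left_inv' s hs := by
    have h : φ.symm ((φ s.1).1, 0) = s.1 := by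
      rw [← hφ.apply_eq s hs, φ.left_inv hs]
    exact (dif_pos (h.symm ▸ s.2)).trans (Subtype.ext h)
  right_inv' e he := by
    rw [dif_pos (hφ.symm_mem he)]
    change (φ (φ.symm (e, 0))).1 = e
    rw [φ.right_inv he]
  open_source := φ.open_source.preimage continuous_subtype_val
  open_target := φ.open_target.preimage (by fun_prop)
  continuousOn_toFun :=
    continuous_fst.comp_continuousOn
      (φ.continuousOn.comp continuous_subtype_val.continuousOn fun _ h => h)
  continuousOn_invFun := by
    rw [Topology.IsInducing.subtypeVal.continuousOn_iff]
    refine (φ.continuousOn_symm.comp (f := fun e : E => (e, (0 : F)))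
      (by fun_prop) fun _ h => h).congr fun e he => ?_
    change (dite _ _ _ : S).1 = _
    rw [dif_pos (hφ.symm_mem he)]
    rfl

open Classical in
theorem chart_symm_coe (hφ : IsSliceChart J S φ) (s₀ : S) {e : E} (he : (e, (0 : F)) ∈ φ.target) :
    ((hφ.chart s₀).symm e : B) = φ.symm (e, 0) := by
  change (dite _ _ _ : S).1 = _
  rw [dif_pos (hφ.symm_mem he)]

/-- In coordinates the transition is `e ↦ (φ' (φ.symm (e, 0))).1`, so any two slice charts induce
compatible charts of `S`. -/
theorem chart_transition (hφ : IsSliceChart J S φ) (hφ' : IsSliceChart J S φ') (s₀ s₁ : S) :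
    ContDiffOn ℝ ∞ ((hφ.chart s₀).symm.trans (hφ'.chart s₁))
      ((hφ.chart s₀).symm.trans (hφ'.chart s₁)).source := by
  have h : ContMDiffOn 𝓘(ℝ, E) 𝓘(ℝ, E × F) ∞ (fun e : E => φ' (φ.symm (e, 0)))
      ((hφ.chart s₀).symm.trans (hφ'.chart s₁)).source := by
    refine hφ'.contMDiffOn.comp (hφ.contMDiffOn_symm.comp
      (contMDiff_iff_contDiff.2 (by fun_prop : ContDiff ℝ ∞ fun e : E => (e, (0 : F)))).contMDiffOn
      (t := φ.target) fun e he => he.1) fun e he => ?_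
    have h₂ : ((hφ.chart s₀).symm e : B) ∈ φ'.source := he.2
    rwa [hφ.chart_symm_coe s₀ he.1] at h₂
  refine (contDiff_fst.comp_contDiffOn (contMDiffOn_iff_contDiffOn.1 h)).congr fun e he => ?_
  change (φ' ((hφ.chart s₀).symm e : B)).1 = _
  rw [hφ.chart_symm_coe s₀ he.1]
  rfl

end IsSliceChart

/-- A subset covered by slice charts is an embedded submanifold, and a map into it that is
the first projection in adapted charts is a submersion. -/
theorem exists_isSmoothEmbedding_isSubmersion [J.Boundaryless] [IsManifold J ∞ B]
    [IsManifold 𝓘(ℝ, EA) ∞ A] (eA : EA ≃L[ℝ] E × G) (eB : (E × F) ≃L[ℝ] EB)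
    (S : Set B)
    (hS : ∀ s ∈ S, ∃ φ : OpenPartialHomeomorph B (E × F), IsSliceChart J S φ ∧ s ∈ φ.source)
    (f : A → S)
    (hf : ∀ x, ∃ (φ : OpenPartialHomeomorph B (E × F)) (χ : OpenPartialHomeomorph A (E × G)),
      IsSliceChart J S φ ∧ x ∈ χ.source ∧
      ContMDiffOn 𝓘(ℝ, EA) 𝓘(ℝ, E × G) ∞ χ χ.source ∧
      ContMDiffOn 𝓘(ℝ, E × G) 𝓘(ℝ, EA) ∞ χ.symm χ.target ∧
      ∀ x' ∈ χ.source, (f x' : B) ∈ φ.source ∧ (φ (f x')).1 = (χ x').1) :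
    ∃ _ : ChartedSpace E S, IsManifold 𝓘(ℝ, E) ∞ S ∧
      Manifold.IsSmoothEmbedding 𝓘(ℝ, E) J ∞ (Subtype.val : S → B) ∧
      Manifold.IsSubmersion 𝓘(ℝ, EA) 𝓘(ℝ, E) ∞ f := by
  choose φ hφ hφs using hS
  -- All slice charts enter the atlas, with `E` and `F` fixed: the dimension of the slice must be
  -- constant.
  let cs : ChartedSpace E S :=
    { atlas := {c | ∃ (φ : OpenPartialHomeomorph B (E × F)) (h : IsSliceChart J S φ) (s₀ : S),
        c = h.chart s₀}
      chartAt := fun s => (hφ s.1 s.2).chart s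
      mem_chart_source := fun s => hφs s.1 s.2
      chart_mem_atlas := fun s => ⟨φ s.1 s.2, hφ s.1 s.2, s, rfl⟩ }
  have mfd : IsManifold 𝓘(ℝ, E) ∞ S := by
    refine isManifold_of_contDiffOn _ _ _ ?_
    rintro _ _ ⟨φ₁, h₁, s₁, rfl⟩ ⟨φ₂, h₂, s₂, rfl⟩
    exact (h₁.chart_transition h₂ s₁ s₂).mono Set.inter_subset_left
  have hchart : ∀ {φ₁ : OpenPartialHomeomorph B (E × F)} (h₁ : IsSliceChart J S φ₁) (s : S),
      h₁.chart s ∈ IsManifold.maximalAtlas 𝓘(ℝ, E) ∞ S := fun h₁ s =>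
    IsManifold.subset_maximalAtlas ⟨_, h₁, s, rfl⟩
  refine ⟨cs, mfd, ⟨Manifold.IsImmersionOfComplement.isImmersion (F := F) fun s => ?_,
    Topology.IsEmbedding.subtypeVal⟩,
    Manifold.IsSubmersionOfComplement.isSubmersion (F := G) fun x => ?_⟩
  · let ψ := φ s.1 s.2
    -- Transported to the model of `B` by `eB`, the slice chart turns the inclusion into `e ↦ eB (e,
    -- 0)`.
    let c : OpenPartialHomeomorph B HB :=
      ψ.trans (eB.toHomeomorph.trans J.toHomeomorph.symm).toOpenPartialHomeomorph
    have hc : c ∈ IsManifold.maximalAtlas J ∞ B := by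
      refine c.mem_maximalAtlas_of_contMDiffOn ?_ ?_
      · have h₁ : ContMDiff 𝓘(ℝ, E × F) 𝓘(ℝ, EB) ∞ eB := contMDiff_iff_contDiff.2 eB.contDiff
        have h₂ : ContMDiff 𝓘(ℝ, EB) J ∞ J.symm := by
          have := J.contMDiffOn_symm (n := ∞)
          rwa [J.range_eq_univ, contMDiffOn_univ] at this
        exact ((h₂.comp h₁).comp_contMDiffOn (hφ s.1 s.2).contMDiffOn).mono
          fun y hy => hy.1
      · have h₁ : ContMDiff 𝓘(ℝ, EB) 𝓘(ℝ, E × F) ∞ eB.symm :=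
          contMDiff_iff_contDiff.2 eB.symm.contDiff
        exact (hφ s.1 s.2).contMDiffOn_symm.comp
          ((h₁.comp J.contMDiff).contMDiffOn) fun y hy => hy.2
    refine Manifold.IsImmersionAtOfComplement.mk_of_continuousAt
      continuous_subtype_val.continuousAt eB ((hφ s.1 s.2).chart s) c (hφs s.1 s.2)
      ⟨hφs s.1 s.2, trivial⟩ (hchart _ _) hc fun e he => ?_
    have he' : e ∈ ((hφ s.1 s.2).chart s).target := by simpa using he
    replace he' : (e, (0 : F)) ∈ ψ.target := he'
    change J (J.symm (eB (ψ ((hφ s.1 s.2).chart s |>.symm e : B)))) = eB (e, 0)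
    rw [(hφ s.1 s.2).chart_symm_coe s he', ψ.right_inv he', J.right_inv (by simp [J.range_eq_univ])]
  · obtain ⟨ψ, χ, hψ, hx, hχ, hχ', hfχ⟩ := hf x
    let c : OpenPartialHomeomorph A EA := χ.trans eA.symm.toHomeomorph.toOpenPartialHomeomorph
    have hc : c ∈ IsManifold.maximalAtlas 𝓘(ℝ, EA) ∞ A := by
      refine c.mem_maximalAtlas_of_contMDiffOn ?_ ?_
      · have h₁ : ContMDiff 𝓘(ℝ, E × G) 𝓘(ℝ, EA) ∞ eA.symm :=
          contMDiff_iff_contDiff.2 eA.symm.contDiff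
        exact (h₁.comp_contMDiffOn hχ).mono fun y hy => hy.1
      · have h₁ : ContMDiff 𝓘(ℝ, EA) 𝓘(ℝ, E × G) ∞ eA := contMDiff_iff_contDiff.2 eA.contDiff
        exact hχ'.comp h₁.contMDiffOn fun y hy => hy.2
    refine Manifold.IsSubmersionAtOfComplement.mk_of_charts eA c (hψ.chart (f x)) ⟨hx, trivial⟩
      (hfχ x hx).1 hc (hchart _ _) (fun y hy => (hfχ y hy.1).1) fun v hv => ?_
    have hv' : eA v ∈ χ.target := by
      have : v ∈ c.target := by simpa using hv
      exact this.2
    change (ψ (f (χ.symm (eA v)))).1 = (eA v).1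
    rw [(hfχ _ (χ.map_target hv')).2, χ.right_inv hv']

end Slices

/-! ### Smooth maps in preferred charts -/

section Charts

variable {M N : SmoothMfd.{u}}

theorem SmoothMfd.contMDiff (f : M ⟶ N) : ContMDiff 𝓘(ℝ, M.model) 𝓘(ℝ, N.model) ∞ f :=
  ContMDiffMap.contMDiff f

theorem SmoothMfd.continuous (f : M ⟶ N) : Continuous f := (SmoothMfd.contMDiff f).continuous

/-- The derivative of a smooth map, read in the preferred charts. -/
def SmoothMfd.derivAt (f : M ⟶ N) (x : M) : M.model →L[ℝ] N.model :=
  mfderiv 𝓘(ℝ, M.model) 𝓘(ℝ, N.model) f x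

theorem SmoothMfd.derivAt_id (x : M) : SmoothMfd.derivAt (𝟙 M) x = ContinuousLinearMap.id ℝ _ :=
  mfderiv_id

theorem SmoothMfd.derivAt_comp {P : SmoothMfd.{u}} (f : M ⟶ N) (g : N ⟶ P) {x : M} {y : N}
    (h : f x = y) :
    SmoothMfd.derivAt (f ≫ g) x = (SmoothMfd.derivAt g y).comp (SmoothMfd.derivAt f x) := by
  subst h
  exact mfderiv_comp x ((SmoothMfd.contMDiff g).mdifferentiable (by simp) _)
    ((SmoothMfd.contMDiff f).mdifferentiable (by simp) _)

/-- A smooth map read in the preferred charts at `x` and `y`. -/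
def SmoothMfd.inCharts (f : M ⟶ N) (x : M) (y : N) (u : M.model) : N.model :=
  chartAt N.model y (f ((chartAt M.model x).symm u))

theorem SmoothMfd.hasFDerivAt_inCharts (f : M ⟶ N) {x : M} {y : N} (h : f x = y) :
    HasFDerivAt (SmoothMfd.inCharts f x y) (SmoothMfd.derivAt f x) (chartAt M.model x x) := by
  subst h
  have := ((SmoothMfd.contMDiff f).mdifferentiable (by simp) x).hasMFDerivAt.2
  simp only [writtenInExtChartAt, Function.comp_def, mfld_simps] at this
  exact hasFDerivWithinAt_univ.1 this

/-- The domain on which a smooth map read in charts is meaningful. -/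
def SmoothMfd.chartDomain (f : M ⟶ N) (x : M) (y : N) : Set M.model :=
  (chartAt M.model x).target ∩ (f ∘ (chartAt M.model x).symm) ⁻¹' (chartAt N.model y).source

theorem SmoothMfd.isOpen_chartDomain (f : M ⟶ N) (x : M) (y : N) :
    IsOpen (SmoothMfd.chartDomain f x y) :=
  ((SmoothMfd.continuous f).comp_continuousOn
    (chartAt M.model x).continuousOn_symm).isOpen_inter_preimage
    (chartAt M.model x).open_target (chartAt N.model y).open_source

theorem SmoothMfd.mem_chartDomain (f : M ⟶ N) {x : M} {y : N} (h : f x = y) :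
    chartAt M.model x x ∈ SmoothMfd.chartDomain f x y := by
  subst h
  exact ⟨mem_chart_target _ _, by simp⟩

theorem SmoothMfd.contDiffOn_inCharts (f : M ⟶ N) (x : M) (y : N) :
    ContDiffOn ℝ ∞ (SmoothMfd.inCharts f x y) (SmoothMfd.chartDomain f x y) := by
  rw [← contMDiffOn_iff_contDiffOn]
  exact (contMDiffOn_chart (I := 𝓘(ℝ, N.model)) (x := y)).comp
    ((SmoothMfd.contMDiff f).comp_contMDiffOn
      ((contMDiffOn_chart_symm (I := 𝓘(ℝ, M.model)) (x := x)).mono Set.inter_subset_left))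
    fun u hu => hu.2

end Charts

/-! ### The tangent simplicial vector space at a base point -/

section Tangent

variable (X : SimplicialObject SmoothMfd.{u}) (p : X _⦋0⦌)

/-- The object `⦋0⦌` is terminal in the simplex category. -/
theorem map_baseInclusion {a b : ℕ} (f : op ⦋a⦌ ⟶ op ⦋b⦌) :
    X.map f (baseInclusion X a p) = baseInclusion X b p := by
  have h : (SimplexCategory.const ⦋a⦌ ⦋0⦌ 0).op ≫ f = (SimplexCategory.const ⦋b⦌ ⦋0⦌ 0).op :=
    Quiver.Hom.unop_inj (Subsingleton.elim _ _)
  change (X.map (SimplexCategory.const ⦋a⦌ ⦋0⦌ 0).op ≫ X.map f) p = _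
  rw [← X.map_comp, h]
  rfl

theorem δ_baseInclusion {n : ℕ} (i : Fin (n + 2)) :
    X.δ i (baseInclusion X (n + 1) p) = baseInclusion X n p :=
  map_baseInclusion X p (SimplexCategory.δ i).op

theorem σ_baseInclusion {n : ℕ} (i : Fin (n + 1)) :
    X.σ i (baseInclusion X n p) = baseInclusion X (n + 1) p :=
  map_baseInclusion X p (SimplexCategory.σ i).op

/-- The derivative at a base point of a map between levels of a simplicial manifold. -/
def baseDeriv {a b : ℕ} (f : X _⦋a⦌ ⟶ X _⦋b⦌) : (X _⦋a⦌).model →L[ℝ] (X _⦋b⦌).model :=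
  SmoothMfd.derivAt f (baseInclusion X a p)

theorem baseDeriv_comp {a b c : ℕ} (f : X _⦋a⦌ ⟶ X _⦋b⦌) (g : X _⦋b⦌ ⟶ X _⦋c⦌)
    (h : f (baseInclusion X a p) = baseInclusion X b p) (v : (X _⦋a⦌).model) :
    baseDeriv X p (f ≫ g) v = baseDeriv X p g (baseDeriv X p f v) := by
  rw [baseDeriv, SmoothMfd.derivAt_comp f g h]
  rfl

theorem baseDeriv_comm {a b b' c : ℕ} {f : X _⦋a⦌ ⟶ X _⦋b⦌} {g : X _⦋b⦌ ⟶ X _⦋c⦌}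
    {f' : X _⦋a⦌ ⟶ X _⦋b'⦌} {g' : X _⦋b'⦌ ⟶ X _⦋c⦌} (h : f ≫ g = f' ≫ g')
    (hf : f (baseInclusion X a p) = baseInclusion X b p)
    (hf' : f' (baseInclusion X a p) = baseInclusion X b' p) (v : (X _⦋a⦌).model) :
    baseDeriv X p g (baseDeriv X p f v) = baseDeriv X p g' (baseDeriv X p f' v) := by
  rw [← baseDeriv_comp X p f g hf, h, baseDeriv_comp X p f' g' hf']

theorem baseDeriv_of_comp_eq_id {a b : ℕ} {f : X _⦋a⦌ ⟶ X _⦋b⦌} {g : X _⦋b⦌ ⟶ X _⦋a⦌}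
    (h : f ≫ g = 𝟙 _) (hf : f (baseInclusion X a p) = baseInclusion X b p) (v : (X _⦋a⦌).model) :
    baseDeriv X p g (baseDeriv X p f v) = v := by
  rw [← baseDeriv_comp X p f g hf, h, baseDeriv, SmoothMfd.derivAt_id]
  rfl

/-- The tangent spaces of a simplicial manifold at a base point form a simplicial vector space. -/
def tangentSimplicialSpace : SimplicialSpace where
  V n := (X _⦋n⦌).model
  d n i := if h : i < n + 2 then (baseDeriv X p (X.δ (⟨i, h⟩ : Fin (n + 2)))).toLinearMap else 0
  s n i := if h : i < n + 1 then (baseDeriv X p (X.σ (⟨i, h⟩ : Fin (n + 1)))).toLinearMap else 0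
  d_d n i j x hij hj := by
    rw [dif_pos (by omega : i < n + 2), dif_pos (by omega : j + 1 < n + 1 + 2),
      dif_pos (by omega : j < n + 2), dif_pos (by omega : i < n + 1 + 2)]
    exact baseDeriv_comm X p (X.δ_comp_δ (i := ⟨i, by omega⟩) (j := ⟨j, by omega⟩) hij)
      (δ_baseInclusion X p _) (δ_baseInclusion X p _) x
  d_s_of_le n i j x hij hj := by
    rw [dif_pos (by omega : i < n + 1 + 2), dif_pos (by omega : j + 1 < n + 1 + 1),
      dif_pos (by omega : j < n + 1), dif_pos (by omega : i < n + 2)]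
    exact baseDeriv_comm X p (X.δ_comp_σ_of_le (i := ⟨i, by omega⟩) (j := ⟨j, by omega⟩) hij)
      (σ_baseInclusion X p _) (δ_baseInclusion X p _) x
  d_s_self n i x hi := by
    rw [dif_pos (by omega : i < n + 2), dif_pos (by omega : i < n + 1)]
    exact baseDeriv_of_comp_eq_id X p (X.δ_comp_σ_self (i := ⟨i, by omega⟩))
      (σ_baseInclusion X p _) x
  d_s_succ n i x hi := by
    rw [dif_pos (by omega : i + 1 < n + 2), dif_pos (by omega : i < n + 1)]
    exact baseDeriv_of_comp_eq_id X p (X.δ_comp_σ_succ (i := ⟨i, by omega⟩))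
      (σ_baseInclusion X p _) x
  d_s_of_gt n i j x hij hi := by
    rw [dif_pos (by omega : i + 1 < n + 1 + 2), dif_pos (by omega : j < n + 1 + 1),
      dif_pos (by omega : j < n + 1), dif_pos (by omega : i < n + 2)]
    exact baseDeriv_comm X p (X.δ_comp_σ_of_gt (i := ⟨i, by omega⟩) (j := ⟨j, by omega⟩) hij)
      (σ_baseInclusion X p _) (δ_baseInclusion X p _) x

instance (n : ℕ) : FiniteDimensional ℝ ((tangentSimplicialSpace X p).V n) :=
  inferInstanceAs (FiniteDimensional ℝ (X _⦋n⦌).model)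

theorem tangentSimplicialSpace_d {n : ℕ} (i : Fin (n + 2)) (v : (X _⦋n + 1⦌).model) :
    (tangentSimplicialSpace X p).d n i v = baseDeriv X p (X.δ i) v := by
  change (dite _ _ _ : (X _⦋n + 1⦌).model →ₗ[ℝ] (X _⦋n⦌).model) v = _
  rw [dif_pos i.2]
  rfl

/-- The derivative at a base point of the horn projection. -/
def hornDeriv (n : ℕ) (I : Finset (Fin (n + 2))) :
    (X _⦋n + 1⦌).model →L[ℝ] ({j // j ∉ I} → (X _⦋n⦌).model) :=
  ContinuousLinearMap.pi fun j => baseDeriv X p (X.δ j.1)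

/-- The indices in the complement of `I`, as natural numbers. -/
def complIndices {n : ℕ} (I : Finset (Fin (n + 2))) : Finset ℕ := Iᶜ.image Fin.val

theorem mem_complIndices {n : ℕ} {I : Finset (Fin (n + 2))} {j : ℕ} :
    j ∈ complIndices I ↔ ∃ h : j < n + 2, (⟨j, h⟩ : Fin (n + 2)) ∉ I := by
  simp only [complIndices, Finset.mem_image, Finset.mem_compl]
  exact ⟨fun ⟨i, hi, h⟩ => h ▸ ⟨i.2, hi⟩, fun ⟨h, hj⟩ => ⟨⟨j, h⟩, hj, rfl⟩⟩

theorem card_complIndices_le {n : ℕ} {I : Finset (Fin (n + 2))} (hI : I.Nonempty) :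
    (complIndices I).card ≤ n + 1 := by
  refine Finset.card_image_le.trans ?_
  have := hI.card_pos
  rw [Finset.card_compl, Fintype.card_fin]
  omega

theorem ker_hornDeriv (n : ℕ) (I : Finset (Fin (n + 2))) :
    LinearMap.ker (hornDeriv X p n I).toLinearMap =
      (tangentSimplicialSpace X p).faceKer (n + 1) (complIndices I) := by
  ext v
  refine Iff.trans ?_ ((tangentSimplicialSpace X p).mem_faceKer_succ n (complIndices I) v).symm
  constructor
  · intro h j hj
    obtain ⟨hj, hjI⟩ := mem_complIndices.1 hj
    exact (tangentSimplicialSpace_d X p ⟨j, hj⟩ v).trans (congrFun h ⟨⟨j, hj⟩, hjI⟩)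
  · intro h
    exact funext fun j => (tangentSimplicialSpace_d X p j.1 v).symm.trans
      (h _ (mem_complIndices.2 ⟨j.1.2, j.2⟩))

/-- The rank of the horn projection is the same at all base points. -/
theorem finrank_range_hornDeriv_eq (q : X _⦋0⦌) (n : ℕ) (I : Finset (Fin (n + 2)))
    (hI : I.Nonempty) :
    Module.finrank ℝ (LinearMap.range (hornDeriv X p n I).toLinearMap) =
      Module.finrank ℝ (LinearMap.range (hornDeriv X q n I).toLinearMap) := by
  have hp := LinearMap.finrank_range_add_finrank_ker
    (hornDeriv X p n I).toLinearMap
  have hq := LinearMap.finrank_range_add_finrank_ker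
    (hornDeriv X q n I).toLinearMap
  -- The levels of both tangent simplicial spaces are the same model spaces; only the operators
  -- depend on the base point.
  have h := (tangentSimplicialSpace X p).finrank_faceKer_eq (tangentSimplicialSpace X q)
    (fun _ => rfl) (complIndices I) (n + 1)
    (fun j hj => by obtain ⟨h, _⟩ := mem_complIndices.1 hj; omega) (card_complIndices_le hI)
  rw [ker_hornDeriv] at hp hq
  exact Nat.add_right_cancel ((hp.trans hq.symm).trans (congrArg (_ + ·) h.symm))

/-- Infinitesimal horns at a base point have fillers. -/
theorem exists_hornDeriv_eq_zero (I : Finset (Fin 2)) (hI : I.Nonempty)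
    (v : {j // j ∉ I} → (X _⦋0⦌).model) : ∃ w, hornDeriv X p 0 I w = v := by
  by_cases h : Nonempty {j // j ∉ I}
  · obtain ⟨j₀⟩ := h
    refine ⟨baseDeriv X p (X.σ (0 : Fin 1)) (v j₀), funext fun j => ?_⟩
    -- A nonempty `I` in `{0, 1}` leaves at most one face, and the degeneracy of its entry is a
    -- filler.
    obtain rfl : j = j₀ := by
      obtain ⟨k, hk⟩ := hI
      obtain ⟨⟨j, hj⟩, hj'⟩ := j
      obtain ⟨⟨l, hl⟩, hl'⟩ := j₀
      have h₁ : (⟨j, hj⟩ : Fin 2) ≠ k := fun h => hj' (h ▸ hk)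
      have h₂ : (⟨l, hl⟩ : Fin 2) ≠ k := fun h => hl' (h ▸ hk)
      simp only [ne_eq, Fin.ext_iff, Subtype.mk.injEq] at h₁ h₂ ⊢
      omega
    obtain ⟨⟨j, hj⟩, hj'⟩ := j
    rcases (by omega : j = 0 ∨ j = 1) with rfl | rfl
    · exact baseDeriv_of_comp_eq_id X p (X.δ_comp_σ_self (i := (0 : Fin 1)))
        (σ_baseInclusion X p _) _
    · exact baseDeriv_of_comp_eq_id X p (X.δ_comp_σ_succ (i := (0 : Fin 1)))
        (σ_baseInclusion X p _) _
  · exact ⟨0, funext fun j => absurd ⟨j⟩ h⟩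

/-- Solutions of the linearized compatibility equations are horns in the tangent simplicial space,
so filling gives the exactness needed for the slice theorem. -/
theorem exists_hornDeriv_eq_succ (n : ℕ) (I : Finset (Fin (n + 3))) (hI : I.Nonempty)
    (v : {j // j ∉ I} → (X _⦋n + 1⦌).model)
    (hv : ∀ (i j : Fin (n + 2)) (hi : i.castSucc ∉ I) (hj : j.succ ∉ I), i ≤ j →
      baseDeriv X p (X.δ i) (v ⟨j.succ, hj⟩) = baseDeriv X p (X.δ j) (v ⟨i.castSucc, hi⟩)) :
    ∃ w, hornDeriv X p (n + 1) I w = v := by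
  classical
  obtain ⟨k, hk⟩ := hI
  let y : ℕ → (tangentSimplicialSpace X p).V (n + 1) := fun j =>
    if h : ∃ h : j < n + 3, (⟨j, h⟩ : Fin (n + 3)) ∉ I then v ⟨⟨j, h.1⟩, h.2⟩ else 0
  have hy : ∀ j (hj : j < n + 3) (hjI : (⟨j, hj⟩ : Fin (n + 3)) ∉ I), y j = v ⟨⟨j, hj⟩, hjI⟩ :=
    fun j hj hjI => dif_pos ⟨hj, hjI⟩
  obtain ⟨w, hw⟩ := (tangentSimplicialSpace X p).exists_filler n (complIndices I) k
    (Nat.lt_succ_iff.1 k.2)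
    (fun h => by obtain ⟨_, h⟩ := mem_complIndices.1 h; exact h hk)
    (fun j hj => by obtain ⟨h, _⟩ := mem_complIndices.1 hj; omega) y
    (fun i j hi hj hij hjn => by
      obtain ⟨hi', hiI⟩ := mem_complIndices.1 hi
      obtain ⟨hj', hjI⟩ := mem_complIndices.1 hj
      rw [hy i hi' hiI, hy (j + 1) hj' hjI]
      have := hv ⟨i, by omega⟩ ⟨j, by omega⟩ hiI hjI hij
      exact (tangentSimplicialSpace_d X p ⟨i, by omega⟩ _).trans
        (this.trans (tangentSimplicialSpace_d X p ⟨j, by omega⟩ _).symm))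
  refine ⟨w, funext fun j => ?_⟩
  have h := hw j.1 (mem_complIndices.2 ⟨j.1.2, j.2⟩)
  rw [hy j.1 j.1.2 j.2] at h
  exact (tangentSimplicialSpace_d X p j.1 w).symm.trans h

end Tangent

/-! ### Local charts of horns at a base point -/

/-- The semisimplicial manifold underlying a simplicial manifold. -/
def SemisimplicialMfd.ofSimplicial (X : SimplicialObject SmoothMfd.{u}) : SemisimplicialMfd.{u} where
  obj n := X _⦋n⦌
  d i := X.δ i
  d_comp_d hij := X.δ_comp_δ hij

section LocalHornChart

variable (X : SimplicialObject SmoothMfd.{u}) (p : X _⦋0⦌) (n : ℕ) (I : Finset (Fin (n + 2)))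

/-- The preferred chart at a base point. -/
def baseChart : OpenPartialHomeomorph (X _⦋n⦌) (X _⦋n⦌).model :=
  chartAt (X _⦋n⦌).model (baseInclusion X n p)

/-- The horn projection read in the preferred charts at a base point. -/
def hornInCharts (u : (X _⦋n + 1⦌).model) (j : {j // j ∉ I}) : (X _⦋n⦌).model :=
  SmoothMfd.inCharts (X.δ j.1) (baseInclusion X (n + 1) p) (baseInclusion X n p) u

variable {E F G : Type}
  [NormedAddCommGroup E] [NormedSpace ℝ E] [NormedAddCommGroup F] [NormedSpace ℝ F]
  [NormedAddCommGroup G] [NormedSpace ℝ G]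

/-- Coordinates around a base point in which the horn space is a linear subspace and the horn
projection is a linear projection. -/
structure IsLocalHornChart (φ : OpenPartialHomeomorph ({j // j ∉ I} → (X _⦋n⦌).model) (E × F))
    (χ : OpenPartialHomeomorph (X _⦋n + 1⦌).model (E × G)) : Prop where
  contDiffOn_left : ContDiffOn ℝ ∞ φ φ.source
  contDiffOn_left_symm : ContDiffOn ℝ ∞ φ.symm φ.target
  contDiffOn_right : ContDiffOn ℝ ∞ χ χ.source
  contDiffOn_right_symm : ContDiffOn ℝ ∞ χ.symm χ.target
  mem_target_left : ∀ y ∈ φ.source, ∀ j, y j ∈ (baseChart X p n).target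
  compatible_iff : ∀ y ∈ φ.source,
    (SemisimplicialMfd.ofSimplicial X).HornCompatible n I
      (fun j => (baseChart X p n).symm (y j)) ↔ (φ y).2 = 0
  base_mem : baseChart X p (n + 1) (baseInclusion X (n + 1) p) ∈ χ.source
  mem_target_right : ∀ u ∈ χ.source, u ∈ (baseChart X p (n + 1)).target
  face_mem : ∀ u ∈ χ.source, ∀ j : {j // j ∉ I},
    X.δ j.1 ((baseChart X p (n + 1)).symm u) ∈ (baseChart X p n).source
  horn_mem : ∀ u ∈ χ.source, hornInCharts X p n I u ∈ φ.source
  horn_eq : ∀ u ∈ χ.source, (φ (hornInCharts X p n I u)).1 = (χ u).1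

theorem hornInCharts_base :
    hornInCharts X p n I (baseChart X p (n + 1) (baseInclusion X (n + 1) p)) =
      fun _ => baseChart X p n (baseInclusion X n p) := by
  funext j
  change chartAt _ _ (X.δ j.1 ((chartAt _ _).symm (chartAt _ _ _))) = _
  rw [(chartAt _ _).left_inv (mem_chart_source _ _), δ_baseInclusion]
  rfl

/-- The equations `g` are left abstract so that the same argument covers 1-horns, which satisfy no
condition, and higher horns. -/
theorem exists_isLocalHornChart_of_equations [FiniteDimensional ℝ E] [FiniteDimensional ℝ F]
    [FiniteDimensional ℝ G] {EC : Type} [NormedAddCommGroup EC] [NormedSpace ℝ EC]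
    [FiniteDimensional ℝ EC]
    (hE : Module.finrank ℝ E = Module.finrank ℝ (LinearMap.range (hornDeriv X p n I).toLinearMap))
    (hF : Module.finrank ℝ E + Module.finrank ℝ F =
      Module.finrank ℝ ({j // j ∉ I} → (X _⦋n⦌).model))
    (hG : Module.finrank ℝ E + Module.finrank ℝ G = Module.finrank ℝ (X _⦋n + 1⦌).model)
    {OB : Set ({j // j ∉ I} → (X _⦋n⦌).model)} (hOB : IsOpen OB)
    (hb : (fun _ => baseChart X p n (baseInclusion X n p)) ∈ OB)
    (hOBt : ∀ y ∈ OB, ∀ j, y j ∈ (baseChart X p n).target)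
    {g : ({j // j ∉ I} → (X _⦋n⦌).model) → EC} (hg : ContDiffOn ℝ ∞ g OB)
    (hgc : ∀ y ∈ OB, g y = 0 ↔ (SemisimplicialMfd.ofSimplicial X).HornCompatible n I
      (fun j => (baseChart X p n).symm (y j)))
    {g' : ({j // j ∉ I} → (X _⦋n⦌).model) →L[ℝ] EC}
    (hg' : HasFDerivAt g g' (fun _ => baseChart X p n (baseInclusion X n p)))
    (hexact : ∀ v, g' v = 0 → ∃ u, hornDeriv X p n I u = v) :
    ∃ (φ : OpenPartialHomeomorph ({j // j ∉ I} → (X _⦋n⦌).model) (E × F))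
      (χ : OpenPartialHomeomorph (X _⦋n + 1⦌).model (E × G)), IsLocalHornChart X p n I φ χ := by
  let a := baseChart X p (n + 1) (baseInclusion X (n + 1) p)
  let OA : Set (X _⦋n + 1⦌).model := (baseChart X p (n + 1)).target ∩
    ⋂ j : {j // j ∉ I}, SmoothMfd.chartDomain (X.δ j.1) (baseInclusion X (n + 1) p)
      (baseInclusion X n p)
  have hOA : IsOpen OA := (baseChart X p (n + 1)).open_target.inter
    (isOpen_iInter_of_finite fun j => SmoothMfd.isOpen_chartDomain _ _ _)
  have ha : a ∈ OA := ⟨mem_chart_target _ _, Set.mem_iInter.2 fun j =>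
    SmoothMfd.mem_chartDomain (X.δ j.1) (δ_baseInclusion X p j.1)⟩
  have hfa : hornInCharts X p n I a = fun _ => baseChart X p n (baseInclusion X n p) :=
    hornInCharts_base X p n I
  have hf : ContDiffOn ℝ ∞ (hornInCharts X p n I) OA := contDiffOn_pi.2 fun j =>
    (SmoothMfd.contDiffOn_inCharts _ _ _).mono fun u hu => Set.mem_iInter.1 hu.2 j
  have hf' : HasFDerivAt (hornInCharts X p n I) (hornDeriv X p n I) a :=
    hasFDerivAt_pi.2 fun j => SmoothMfd.hasFDerivAt_inCharts (X.δ j.1) (δ_baseInclusion X p j.1)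
  have hgf : ∀ u ∈ OA, hornInCharts X p n I u ∈ OB → g (hornInCharts X p n I u) = 0 := by
    intro u hu hfu
    rw [hgc _ hfu]
    have h : (fun j => (baseChart X p n).symm (hornInCharts X p n I u j)) =
        fun j => X.δ j.1 ((baseChart X p (n + 1)).symm u) :=
      funext fun j => (chartAt _ _).left_inv (Set.mem_iInter.1 hu.2 j).2
    rw [h]
    exact (SemisimplicialMfd.ofSimplicial X).hornCompatible_faces n I _
  obtain ⟨φ, χ, hφO, hχO, haχ, h₁, h₂, h₃, h₄, h₅, h₆⟩ := exists_slice_of_exact (E := E) (F := F)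
    (G := G) hOA hOB ha (hfa ▸ hb) hf hg hgf hf' (hfa ▸ hg') hexact hE hF hG
  exact ⟨φ, χ, h₁, h₂, h₃, h₄, fun y hy => hOBt y (hφO hy),
    fun y hy => (hgc y (hφO hy)).symm.trans (h₅ y hy), haχ, fun u hu => (hχO hu).1,
    fun u hu j => (Set.mem_iInter.1 (hχO hu).2 j).2, fun u hu => (h₆ u hu).1,
    fun u hu => (h₆ u hu).2⟩

theorem exists_isLocalHornChart [FiniteDimensional ℝ E] [FiniteDimensional ℝ F]
    [FiniteDimensional ℝ G] (hI : I.Nonempty)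
    (hE : Module.finrank ℝ E = Module.finrank ℝ (LinearMap.range (hornDeriv X p n I).toLinearMap))
    (hF : Module.finrank ℝ E + Module.finrank ℝ F =
      Module.finrank ℝ ({j // j ∉ I} → (X _⦋n⦌).model))
    (hG : Module.finrank ℝ E + Module.finrank ℝ G = Module.finrank ℝ (X _⦋n + 1⦌).model) :
    ∃ (φ : OpenPartialHomeomorph ({j // j ∉ I} → (X _⦋n⦌).model) (E × F))
      (χ : OpenPartialHomeomorph (X _⦋n + 1⦌).model (E × G)), IsLocalHornChart X p n I φ χ := by
  let T : Set ({j // j ∉ I} → (X _⦋n⦌).model) := {y | ∀ j, y j ∈ (baseChart X p n).target}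
  have hT : IsOpen T := by
    simp only [T, Set.ofPred_forall]
    exact isOpen_iInter_of_finite fun j =>
      (baseChart X p n).open_target.preimage (continuous_apply j)
  have hTb : (fun _ => baseChart X p n (baseInclusion X n p)) ∈ T := fun _ => mem_chart_target _ _
  cases n with
  | zero =>
    -- There are no equations here, so `g = 0` and exactness means surjectivity of the derivative.
    exact exists_isLocalHornChart_of_equations X p 0 I hE hF hG hT hTb (fun y hy => hy)
      (g := fun _ => (0 : ℝ)) contDiffOn_const (fun y hy => iff_of_true rfl trivial)
      (hasFDerivAt_const _ _) fun v _ => exists_hornDeriv_eq_zero X p I hI v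
  | succ n =>
    let C := {q : Fin (n + 2) × Fin (n + 2) // q.1.castSucc ∉ I ∧ q.2.succ ∉ I ∧ q.1 ≤ q.2}
    let face (i : Fin (n + 2)) : (X _⦋n + 1⦌).model → (X _⦋n⦌).model :=
      SmoothMfd.inCharts (X.δ i) (baseInclusion X (n + 1) p) (baseInclusion X n p)
    let dom (i : Fin (n + 2)) : Set (X _⦋n + 1⦌).model :=
      SmoothMfd.chartDomain (X.δ i) (baseInclusion X (n + 1) p) (baseInclusion X n p)
    -- All faces of all entries stay in the chart domain. There, equality of faces is equivalent to
    -- equality of coordinates, and `g` can be their difference.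
    let OB : Set ({j // j ∉ I} → (X _⦋n + 1⦌).model) :=
      T ∩ ⋂ (j : {j // j ∉ I}) (i : Fin (n + 2)), (fun y => y j) ⁻¹' dom i
    have hOB : IsOpen OB := hT.inter (isOpen_iInter_of_finite fun j =>
      isOpen_iInter_of_finite fun i =>
        (SmoothMfd.isOpen_chartDomain _ _ _).preimage (continuous_apply j))
    have hdom : ∀ y ∈ OB, ∀ j i, y j ∈ dom i := fun y hy j i =>
      Set.mem_iInter.1 (Set.mem_iInter.1 hy.2 j) i
    have hb : (fun _ => baseChart X p (n + 1) (baseInclusion X (n + 1) p)) ∈ OB :=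
      ⟨hTb, Set.mem_iInter.2 fun j => Set.mem_iInter.2 fun i =>
        SmoothMfd.mem_chartDomain (X.δ i) (δ_baseInclusion X p i)⟩
    let ev (j : {j // j ∉ I}) : ({j // j ∉ I} → (X _⦋n + 1⦌).model) →L[ℝ] (X _⦋n + 1⦌).model :=
      ContinuousLinearMap.proj j
    let g (y : {j // j ∉ I} → (X _⦋n + 1⦌).model) (c : C) : (X _⦋n⦌).model :=
      face c.1.1 (y ⟨c.1.2.succ, c.2.2.1⟩) - face c.1.2 (y ⟨c.1.1.castSucc, c.2.1⟩)
    let g' : ({j // j ∉ I} → (X _⦋n + 1⦌).model) →L[ℝ] (C → (X _⦋n⦌).model) :=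
      ContinuousLinearMap.pi fun c =>
        (baseDeriv X p (X.δ c.1.1)).comp (ev ⟨c.1.2.succ, c.2.2.1⟩) -
          (baseDeriv X p (X.δ c.1.2)).comp (ev ⟨c.1.1.castSucc, c.2.1⟩)
    have hfc : ∀ i j, ContDiffOn ℝ ∞ (fun y => face i (y j)) OB := fun i j =>
      (SmoothMfd.contDiffOn_inCharts _ _ _).comp (ev j).contDiff.contDiffOn
        fun y hy => hdom y hy j i
    have hfd : ∀ i j, HasFDerivAt (fun y => face i (y j)) ((baseDeriv X p (X.δ i)).comp (ev j))
        (fun _ => baseChart X p (n + 1) (baseInclusion X (n + 1) p)) := by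
      intro i j
      have h : HasFDerivAt (face i) (baseDeriv X p (X.δ i))
          (ev j fun _ => baseChart X p (n + 1) (baseInclusion X (n + 1) p)) :=
        SmoothMfd.hasFDerivAt_inCharts (X.δ i) (δ_baseInclusion X p i)
      exact h.comp _ (ev j).hasFDerivAt
    refine exists_isLocalHornChart_of_equations X p (n + 1) I hE hF hG hOB hb (fun y hy => hy.1)
      (g := g) (g' := g') (contDiffOn_pi.2 fun c => (hfc _ _).sub (hfc _ _)) (fun y hy => ?_)
      (hasFDerivAt_pi.2 fun c => (hfd _ _).sub (hfd _ _)) fun v hv => ?_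
    · constructor
      · intro h i j hi hj hij
        have h' := congrFun h ⟨(i, j), hi, hj, hij⟩
        exact (chartAt _ _).injOn (hdom y hy _ _).2 (hdom y hy _ _).2 (sub_eq_zero.1 h')
      · intro h
        funext c
        exact sub_eq_zero.2 (congrArg _ (h c.1.1 c.1.2 c.2.1 c.2.2.1 c.2.2.2))
    · exact exists_hornDeriv_eq_succ X p n I hI v fun i j hi hj hij =>
        sub_eq_zero.1 (congrFun hv ⟨(i, j), hi, hj, hij⟩)

end LocalHornChart

/-! ### From local charts to the Kan condition -/

section Kan

variable (X : SimplicialObject SmoothMfd.{u})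

/-- Compatibility does not depend on `U`, so charts built for `X` restrict to every face-stable
family. -/
theorem hornCompatible_ofFaceStable (U : ∀ n : ℕ, Opens (X _⦋n⦌))
    (hU : ∀ (n : ℕ) (i : Fin (n + 2)), Set.MapsTo (X.δ i) (U (n + 1)) (U n))
    (n : ℕ) (I : Finset (Fin (n + 2))) (y : {j // j ∉ I} → U n) :
    (SemisimplicialMfd.ofFaceStable X U hU).HornCompatible n I y ↔
      (SemisimplicialMfd.ofSimplicial X).HornCompatible n I (fun j => (y j).1) := by
  cases n with
  | zero => exact Iff.rfl
  | succ n =>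
    exact forall₂_congr fun i j => forall₃_congr fun hi hj hij => Subtype.ext_iff

variable {E F G : Type}
  [NormedAddCommGroup E] [NormedSpace ℝ E] [NormedAddCommGroup F] [NormedSpace ℝ F]
  [NormedAddCommGroup G] [NormedSpace ℝ G]
  {X} {n : ℕ} {I : Finset (Fin (n + 2))}

variable (X) in
/-- The tuples of simplices lying in the domain of a chart of horns at a base point. -/
def hornNhd (p : X _⦋0⦌) (φ : OpenPartialHomeomorph ({j // j ∉ I} → (X _⦋n⦌).model) (E × F)) :
    Set ({j // j ∉ I} → X _⦋n⦌) :=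
  {y | (∀ j, y j ∈ (baseChart X p n).source) ∧ (fun j => baseChart X p n (y j)) ∈ φ.source}

variable (X) in
/-- The simplices lying in the domain of a chart at a base point. -/
def simplexNhd (p : X _⦋0⦌) (χ : OpenPartialHomeomorph (X _⦋n + 1⦌).model (E × G)) :
    Set (X _⦋n + 1⦌) :=
  (baseChart X p (n + 1)).source ∩ baseChart X p (n + 1) ⁻¹' χ.source

omit [NormedSpace ℝ E] [NormedSpace ℝ F] in
theorem isOpen_hornNhd (p : X _⦋0⦌)
    (φ : OpenPartialHomeomorph ({j // j ∉ I} → (X _⦋n⦌).model) (E × F)) :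
    IsOpen (hornNhd X p φ) := by
  convert (OpenPartialHomeomorph.pi fun _ : {j // j ∉ I} =>
    baseChart X p n).isOpen_inter_preimage φ.open_source using 1
  ext y
  exact and_congr_left' ⟨fun h j _ => h j, fun h j => h j trivial⟩

omit [NormedSpace ℝ E] [NormedSpace ℝ G] in
theorem isOpen_simplexNhd (p : X _⦋0⦌)
    (χ : OpenPartialHomeomorph (X _⦋n + 1⦌).model (E × G)) : IsOpen (simplexNhd X p χ) :=
  (baseChart X p (n + 1)).isOpen_inter_preimage χ.open_source

theorem IsLocalHornChart.base_mem_simplexNhd {p : X _⦋0⦌}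
    {φ : OpenPartialHomeomorph ({j // j ∉ I} → (X _⦋n⦌).model) (E × F)}
    {χ : OpenPartialHomeomorph (X _⦋n + 1⦌).model (E × G)} (h : IsLocalHornChart X p n I φ χ) :
    baseInclusion X (n + 1) p ∈ simplexNhd X p χ :=
  ⟨mem_chart_source _ _, h.base_mem⟩

theorem IsLocalHornChart.base_mem_hornNhd {p : X _⦋0⦌}
    {φ : OpenPartialHomeomorph ({j // j ∉ I} → (X _⦋n⦌).model) (E × F)}
    {χ : OpenPartialHomeomorph (X _⦋n + 1⦌).model (E × G)} (h : IsLocalHornChart X p n I φ χ) :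
    (fun _ => baseInclusion X n p) ∈ hornNhd X p φ :=
  ⟨fun _ => mem_chart_source _ _, by
    have := h.horn_mem _ h.base_mem
    rwa [hornInCharts_base] at this⟩

section

variable {U : ∀ n : ℕ, Opens (X _⦋n⦌)}
  (hU : ∀ (n : ℕ) (i : Fin (n + 2)), Set.MapsTo (X.δ i) (U (n + 1)) (U n))
  {p : X _⦋0⦌} (φ : OpenPartialHomeomorph ({j // j ∉ I} → (X _⦋n⦌).model) (E × F))
  (χ : OpenPartialHomeomorph (X _⦋n + 1⦌).model (E × G))
  (hp : ∀ n, baseInclusion X n p ∈ U n)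

/-- The preferred chart at a base point, restricted to `U`. -/
def restrBaseChart (n : ℕ) :
    OpenPartialHomeomorph ((SemisimplicialMfd.ofFaceStable X U hU).obj n)
      ((SemisimplicialMfd.ofFaceStable X U hU).obj n).model :=
  (baseChart X p n).subtypeRestr (s := U n) ⟨⟨_, hp n⟩⟩

theorem restrBaseChart_mem_maximalAtlas (n : ℕ) :
    restrBaseChart hU hp n ∈ IsManifold.maximalAtlas
      𝓘(ℝ, ((SemisimplicialMfd.ofFaceStable X U hU).obj n).model) ∞
      ((SemisimplicialMfd.ofFaceStable X U hU).obj n) :=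
  StructureGroupoid.subtypeRestr_mem_maximalAtlas (H := (X _⦋n⦌).model) (s := U n)
    (G := contDiffGroupoid ∞ 𝓘(ℝ, (X _⦋n⦌).model))
    (chart_mem_atlas _ (baseInclusion X n p)) ⟨⟨_, hp n⟩⟩

theorem mem_restrBaseChart_source (n : ℕ) (x : (SemisimplicialMfd.ofFaceStable X U hU).obj n) :
    x ∈ (restrBaseChart hU hp n).source ↔ x.1 ∈ (baseChart X p n).source := by
  unfold restrBaseChart
  exact Set.ext_iff.1 (OpenPartialHomeomorph.subtypeRestr_source _ _) x

/-- The chart of tuples of simplices in `U` at a base point. -/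
def hornChart :
    OpenPartialHomeomorph ({j // j ∉ I} → (SemisimplicialMfd.ofFaceStable X U hU).obj n) (E × F) :=
  OpenPartialHomeomorph.transModel
    (J := ModelWithCorners.pi fun _ : {j // j ∉ I} =>
      𝓘(ℝ, ((SemisimplicialMfd.ofFaceStable X U hU).obj n).model))
    (OpenPartialHomeomorph.pi fun _ : {j // j ∉ I} => restrBaseChart hU hp n) φ

/-- The chart of simplices in `U` at a base point. -/
def simplexChart :
    OpenPartialHomeomorph ((SemisimplicialMfd.ofFaceStable X U hU).obj (n + 1)) (E × G) :=
  OpenPartialHomeomorph.transModel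
    (J := 𝓘(ℝ, ((SemisimplicialMfd.ofFaceStable X U hU).obj (n + 1)).model))
    (restrBaseChart hU hp (n + 1)) χ

omit [NormedSpace ℝ E] [NormedSpace ℝ F] in
theorem mem_hornChart_source (y : {j // j ∉ I} → (SemisimplicialMfd.ofFaceStable X U hU).obj n) :
    y ∈ (hornChart hU φ hp).source ↔ (fun j => (y j).1) ∈ hornNhd X p φ := by
  constructor
  · rintro ⟨⟨h₁, _⟩, h₂⟩
    exact ⟨fun j => (mem_restrBaseChart_source hU hp n _).1 (h₁ j trivial), h₂⟩
  · rintro ⟨h₁, h₂⟩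
    exact ⟨⟨fun j _ => (mem_restrBaseChart_source hU hp n _).2 (h₁ j), trivial⟩, h₂⟩

omit [NormedSpace ℝ E] [NormedSpace ℝ G] in
theorem mem_simplexChart_source (x : (SemisimplicialMfd.ofFaceStable X U hU).obj (n + 1)) :
    x ∈ (simplexChart hU χ hp).source ↔ x.1 ∈ simplexNhd X p χ := by
  constructor
  · rintro ⟨⟨h₁, _⟩, h₂⟩
    exact ⟨(mem_restrBaseChart_source hU hp _ _).1 h₁, h₂⟩
  · rintro ⟨h₁, h₂⟩
    exact ⟨⟨(mem_restrBaseChart_source hU hp _ _).2 h₁, trivial⟩, h₂⟩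

variable {φ χ}

theorem IsLocalHornChart.isSliceChart (h : IsLocalHornChart X p n I φ χ) :
    IsSliceChart (ModelWithCorners.pi fun _ : {j // j ∉ I} =>
        𝓘(ℝ, ((SemisimplicialMfd.ofFaceStable X U hU).obj n).model))
      ((SemisimplicialMfd.ofFaceStable X U hU).hornSpace n I) (hornChart hU φ hp) where
  contMDiffOn := OpenPartialHomeomorph.contMDiffOn_transModel
    (IsManifold.pi_mem_maximalAtlas fun _ => restrBaseChart_mem_maximalAtlas hU hp n)
    h.contDiffOn_left
  contMDiffOn_symm := OpenPartialHomeomorph.contMDiffOn_transModel_symm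
    (IsManifold.pi_mem_maximalAtlas fun _ => restrBaseChart_mem_maximalAtlas hU hp n)
    h.contDiffOn_left_symm
  mem_iff y hy := by
    have hy' := (mem_hornChart_source hU φ hp y).1 hy
    refine (hornCompatible_ofFaceStable X U hU n I y).trans ?_
    have h' := h.compatible_iff _ hy'.2
    have hinv : (fun j => (baseChart X p n).symm (baseChart X p n (y j).1)) = fun j => (y j).1 :=
      funext fun j => (baseChart X p n).left_inv (hy'.1 j)
    rw [hinv] at h'
    exact h'

theorem IsLocalHornChart.contMDiffOn_simplexChart (h : IsLocalHornChart X p n I φ χ) :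
    ContMDiffOn 𝓘(ℝ, ((SemisimplicialMfd.ofFaceStable X U hU).obj (n + 1)).model) 𝓘(ℝ, E × G) ∞
      (simplexChart hU χ hp) (simplexChart hU χ hp).source :=
  OpenPartialHomeomorph.contMDiffOn_transModel (restrBaseChart_mem_maximalAtlas hU hp (n + 1))
    h.contDiffOn_right

theorem IsLocalHornChart.contMDiffOn_simplexChart_symm (h : IsLocalHornChart X p n I φ χ) :
    ContMDiffOn 𝓘(ℝ, E × G) 𝓘(ℝ, ((SemisimplicialMfd.ofFaceStable X U hU).obj (n + 1)).model) ∞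
      (simplexChart hU χ hp).symm (simplexChart hU χ hp).target :=
  OpenPartialHomeomorph.contMDiffOn_transModel_symm
    (restrBaseChart_mem_maximalAtlas hU hp (n + 1)) h.contDiffOn_right_symm

theorem IsLocalHornChart.hornProj_mem (h : IsLocalHornChart X p n I φ χ)
    (x : (SemisimplicialMfd.ofFaceStable X U hU).obj (n + 1))
    (hx : x ∈ (simplexChart hU χ hp).source) :
    ((SemisimplicialMfd.ofFaceStable X U hU).hornProj n I x).1 ∈ (hornChart hU φ hp).source ∧
      (hornChart hU φ hp ((SemisimplicialMfd.ofFaceStable X U hU).hornProj n I x).1).1 =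
        (simplexChart hU χ hp x).1 := by
  have hx := (mem_simplexChart_source hU χ hp x).1 hx
  have hinv : (baseChart X p (n + 1)).symm (baseChart X p (n + 1) x.1) = x.1 :=
    (baseChart X p (n + 1)).left_inv hx.1
  have hhorn : hornInCharts X p n I (baseChart X p (n + 1) x.1) =
      fun j => baseChart X p n (X.δ j.1 x.1) :=
    funext fun j => congrArg (fun z => baseChart X p n (X.δ j.1 z)) hinv
  refine ⟨(mem_hornChart_source hU φ hp _).2 ⟨fun j => ?_, ?_⟩, ?_⟩
  · have := h.face_mem _ hx.2 j
    rw [hinv] at this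
    exact this
  · have := h.horn_mem _ hx.2
    rw [hhorn] at this
    exact this
  · have := h.horn_eq _ hx.2
    rw [hhorn] at this
    exact this

end

/-- A family of open neighbourhoods covered by local charts of horns satisfies the Kan
condition. -/
theorem kan_of_isLocalHornChart (U : ∀ n : ℕ, Opens (X _⦋n⦌))
    (hU : ∀ (n : ℕ) (i : Fin (n + 2)), Set.MapsTo (X.δ i) (U (n + 1)) (U n))
    (hbase : ∀ n p, baseInclusion X n p ∈ U n)
    [FiniteDimensional ℝ E] [FiniteDimensional ℝ F] [FiniteDimensional ℝ G]
    (hF : Module.finrank ℝ E + Module.finrank ℝ F =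
      Module.finrank ℝ ({j // j ∉ I} → (X _⦋n⦌).model))
    (hG : Module.finrank ℝ E + Module.finrank ℝ G = Module.finrank ℝ (X _⦋n + 1⦌).model)
    {φ : X _⦋0⦌ → OpenPartialHomeomorph ({j // j ∉ I} → (X _⦋n⦌).model) (E × F)}
    {χ : X _⦋0⦌ → OpenPartialHomeomorph (X _⦋n + 1⦌).model (E × G)}
    (h : ∀ p, IsLocalHornChart X p n I (φ p) (χ p))
    (hW : ∀ y : {j // j ∉ I} → X _⦋n⦌, (∀ j, y j ∈ U n) →
      (SemisimplicialMfd.ofSimplicial X).HornCompatible n I y → ∃ p, y ∈ hornNhd X p (φ p))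
    (hV : ∀ x ∈ U (n + 1), ∃ p, x ∈ simplexNhd X p (χ p)) :
    (SemisimplicialMfd.ofFaceStable X U hU).Kan n I := by
  let Y := SemisimplicialMfd.ofFaceStable X U hU
  have eA : (Y.obj (n + 1)).model ≃L[ℝ] E × G :=
    ContinuousLinearEquiv.ofFinrankEq (by rw [Module.finrank_prod]; exact hG.symm)
  have eB : (E × F) ≃L[ℝ] ({j // j ∉ I} → (Y.obj n).model) :=
    ContinuousLinearEquiv.ofFinrankEq (by rw [Module.finrank_prod]; exact hF)
  obtain ⟨cs, h₁, h₂, h₃⟩ := exists_isSmoothEmbedding_isSubmersion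
    (J := ModelWithCorners.pi fun _ : {j // j ∉ I} => 𝓘(ℝ, (Y.obj n).model))
    (A := Y.obj (n + 1)) eA eB (Y.hornSpace n I) (fun s hs => by
      obtain ⟨p, hp⟩ := hW (fun j => (s j).1) (fun j => (s j).2)
        ((hornCompatible_ofFaceStable X U hU n I s).1 hs)
      exact ⟨hornChart hU (φ p) (hbase · p), (h p).isSliceChart hU _,
        (mem_hornChart_source hU (φ p) _ s).2 hp⟩)
    (Y.hornProj n I) (fun x => by
      obtain ⟨p, hp⟩ := hV x.1 x.2
      exact ⟨hornChart hU (φ p) (hbase · p), simplexChart hU (χ p) (hbase · p),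
        (h p).isSliceChart hU _, (mem_simplexChart_source hU (χ p) _ x).2 hp,
        (h p).contMDiffOn_simplexChart hU _, (h p).contMDiffOn_simplexChart_symm hU _,
        fun x' hx' => (h p).hornProj_mem hU _ x' hx'⟩)
  exact ⟨E, _, _, inferInstance, cs, h₁, h₂, h₃⟩

end Kan

/-! ### Small neighbourhoods of the base -/

/-- If points sufficiently close to the base points are pairwise related by having a common vertex,
then they are simultaneously close to a single base point. -/
theorem exists_isOpen_of_common_vertices {Z P ι κ : Type*} [TopologicalSpace Z]
    [MetrizableSpace Z] [Fintype ι] [Nonempty ι] [Finite κ] (s : P → Z) (w : κ → Z → Z)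
    (hw : ∀ c, Continuous (w c)) (hws : ∀ c p, w c (s p) = s p) {W : Set (ι → Z)} (hWo : IsOpen W)
    (hW : ∀ p, (fun _ => s p) ∈ W) :
    ∃ T : Set Z, IsOpen T ∧ (∀ p, s p ∈ T) ∧ ∀ y : ι → Z, (∀ i, y i ∈ T) →
      (∀ i j, i ≠ j → ∃ c c', w c (y i) = w c' (y j)) → y ∈ W := by
  let _ : MetricSpace Z := metrizableSpaceMetric Z
  have h : ∀ p, ∃ ε > 0, Metric.ball (fun _ : ι => s p) ε ⊆ W := fun p =>
    Metric.isOpen_iff.1 hWo _ (hW p)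
  choose ε hε hεW using h
  refine ⟨⋃ p, Metric.ball (s p) (ε p / 4) ∩ ⋂ c, w c ⁻¹' Metric.ball (s p) (ε p / 4),
    isOpen_iUnion fun p => Metric.isOpen_ball.inter
      (isOpen_iInter_of_finite fun c => Metric.isOpen_ball.preimage (hw c)), fun p => ?_, ?_⟩
  · have := hε p
    refine Set.mem_iUnion.2 ⟨p, Metric.mem_ball_self (by linarith), Set.mem_iInter.2 fun c => ?_⟩
    rw [Set.mem_preimage, hws]
    exact Metric.mem_ball_self (by linarith)
  · intro y hy hyy
    simp only [Set.mem_iUnion, Set.mem_inter_iff, Set.mem_iInter, Set.mem_preimage,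
      Metric.mem_ball] at hy
    choose q hq hqw using hy
    -- Take the base point with the largest radius. The path from `y j` through `s (q j)` and the
    -- common vertex to `s (q i)` has three legs, each shorter than a quarter of that radius.
    obtain ⟨i, hi⟩ := Finite.exists_max fun i => ε (q i)
    refine hεW (q i) (Metric.mem_ball.2 ((dist_pi_lt_iff (hε _)).2 fun j => ?_))
    have hεi := hε (q i)
    by_cases hij : j = i
    · subst hij
      linarith [hq j]
    · obtain ⟨c, c', hc⟩ := hyy j i hij
      have h₁ := hq j
      have h₂ := hqw j c
      have h₃ := hqw i c'
      rw [← hc] at h₃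
      have h₄ := hi j
      have h₅ := dist_triangle (y j) (s (q j)) (s (q i))
      have h₆ := dist_triangle_left (s (q j)) (s (q i)) (w c (y j))
      linarith

section Neighborhoods

variable (X : SimplicialObject SmoothMfd.{u})

/-- Local compactness and the Hausdorff property give regularity, and second countability then gives
a metric. -/
instance (M : SmoothMfd.{u}) : MetrizableSpace M := by
  have : LocallyCompactSpace M := ChartedSpace.locallyCompactSpace M.model M
  exact metrizableSpace_of_t3_secondCountable _

/-- The vertices of a simplex, as degenerate simplices. -/
def vertexMap (n : ℕ) (c : Fin (n + 1)) : X _⦋n⦌ ⟶ X _⦋n⦌ :=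
  X.map (SimplexCategory.const ⦋0⦌ ⦋n⦌ c).op ≫ baseInclusion X n

theorem vertexMap_baseInclusion (n : ℕ) (c : Fin (n + 1)) (p : X _⦋0⦌) :
    vertexMap X n c (baseInclusion X n p) = baseInclusion X n p := by
  have h := map_baseInclusion X p (SimplexCategory.const ⦋0⦌ ⦋n⦌ c).op
  have h₀ : baseInclusion X 0 p = p := by
    rw [baseInclusion, show SimplexCategory.const ⦋0⦌ ⦋0⦌ 0 = 𝟙 _ from Subsingleton.elim _ _,
      op_id, X.map_id]
    rfl
  rw [h₀] at h
  exact congrArg (baseInclusion X n) h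

/-- Vertex `0` of the common face is a vertex of both simplices, namely number `δ i 0` of `x` and `δ
j 0` of `y`. -/
theorem exists_vertexMap_eq {n : ℕ} {i j : Fin (n + 2)} {x y : X _⦋n + 1⦌}
    (h : X.δ i x = X.δ j y) : ∃ c c', vertexMap X (n + 1) c x = vertexMap X (n + 1) c' y := by
  have key : ∀ (i : Fin (n + 2)) (x : X _⦋n + 1⦌),
      X.map (SimplexCategory.const ⦋0⦌ ⦋n⦌ 0).op (X.δ i x) =
        X.map (SimplexCategory.const ⦋0⦌ ⦋n + 1⦌ (SimplexCategory.δ i 0)).op x := by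
    intro i x
    change (X.map (SimplexCategory.δ i).op ≫ X.map (SimplexCategory.const ⦋0⦌ ⦋n⦌ 0).op) x = _
    rw [← X.map_comp, ← op_comp, SimplexCategory.const_comp]
    rfl
  refine ⟨SimplexCategory.δ i 0, SimplexCategory.δ j 0, congrArg (baseInclusion X (n + 1)) ?_⟩
  exact (key i x).symm.trans ((congrArg _ h).trans (key j y))

theorem exists_vertexMap_eq_of_hornCompatible (n : ℕ) (I : Finset (Fin (n + 2))) (hI : I.Nonempty)
    (y : {j // j ∉ I} → X _⦋n⦌) (hy : (SemisimplicialMfd.ofSimplicial X).HornCompatible n I y)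
    (a b : {j // j ∉ I}) (hab : a ≠ b) :
    ∃ c c', vertexMap X n c (y a) = vertexMap X n c' (y b) := by
  cases n with
  | zero =>
    exfalso
    obtain ⟨k, hk⟩ := hI
    have h₁ : a.1 ≠ k := fun h => a.2 (h ▸ hk)
    have h₂ : b.1 ≠ k := fun h => b.2 (h ▸ hk)
    have h₃ : a.1 ≠ b.1 := fun h => hab (Subtype.ext h)
    omega
  | succ n =>
    have key : ∀ a b : {j // j ∉ I}, a.1 < b.1 →
        ∃ c c', vertexMap X (n + 1) c (y b) = vertexMap X (n + 1) c' (y a) := by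
      rintro ⟨a, ha⟩ ⟨b, hb⟩ hab
      obtain ⟨i, rfl⟩ := Fin.exists_castSucc_eq.2 (Fin.ne_last_of_lt hab)
      obtain ⟨j, rfl⟩ := Fin.exists_succ_eq.2 (Fin.ne_zero_of_lt hab)
      exact exists_vertexMap_eq X (hy i j ha hb (Fin.castSucc_lt_succ_iff.1 hab))
    rcases lt_or_gt_of_ne (fun h => hab (Subtype.ext h) : a.1 ≠ b.1) with h | h
    · obtain ⟨c, c', h⟩ := key a b h
      exact ⟨c', c, h.symm⟩
    · exact key b a h

/-- Provides one rank for all base points, including when the base is empty; it fixes the model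
spaces of the charts. -/
theorem exists_finrank_range_hornDeriv (n : ℕ) (I : Finset (Fin (n + 2))) (hI : I.Nonempty) :
    ∃ r, r ≤ Module.finrank ℝ ({j // j ∉ I} → (X _⦋n⦌).model) ∧
      r ≤ Module.finrank ℝ (X _⦋n + 1⦌).model ∧
      ∀ p, Module.finrank ℝ (LinearMap.range (hornDeriv X p n I).toLinearMap) = r := by
  rcases isEmpty_or_nonempty (X _⦋0⦌) with h | ⟨⟨q⟩⟩
  · exact ⟨0, zero_le, zero_le, fun p => h.elim p⟩
  · exact ⟨_, Submodule.finrank_le _, LinearMap.finrank_range_le _, fun p =>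
      finrank_range_hornDeriv_eq X p q n I hI⟩

/-- The Kan condition holds for all sufficiently small neighbourhoods of the base. -/
theorem exists_opens_forall_kan (n : ℕ) (I : Finset (Fin (n + 2))) (hI : I.Nonempty)
    (hI' : ∃ j, j ∉ I) :
    ∃ (T : Opens (X _⦋n⦌)) (V : Opens (X _⦋n + 1⦌)),
      (∀ p, baseInclusion X n p ∈ T) ∧ (∀ p, baseInclusion X (n + 1) p ∈ V) ∧
      ∀ (U : ∀ n : ℕ, Opens (X _⦋n⦌))
        (hU : ∀ (n : ℕ) (i : Fin (n + 2)), Set.MapsTo (X.δ i) (U (n + 1)) (U n)),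
        (∀ n p, baseInclusion X n p ∈ U n) → U n ≤ T → U (n + 1) ≤ V →
        (SemisimplicialMfd.ofFaceStable X U hU).Kan n I := by
  obtain ⟨r, hrB, hrA, hr⟩ := exists_finrank_range_hornDeriv X n I hI
  have hF : Module.finrank ℝ (Fin r → ℝ) + Module.finrank ℝ
      (Fin (Module.finrank ℝ ({j // j ∉ I} → (X _⦋n⦌).model) - r) → ℝ) =
      Module.finrank ℝ ({j // j ∉ I} → (X _⦋n⦌).model) := by
    rw [Module.finrank_fin_fun, Module.finrank_fin_fun]
    omega
  have hG : Module.finrank ℝ (Fin r → ℝ) + Module.finrank ℝ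
      (Fin (Module.finrank ℝ (X _⦋n + 1⦌).model - r) → ℝ) =
      Module.finrank ℝ (X _⦋n + 1⦌).model := by
    rw [Module.finrank_fin_fun, Module.finrank_fin_fun]
    omega
  choose φ χ h using fun p => exists_isLocalHornChart X p n I hI
    (by rw [hr, Module.finrank_fin_fun]) hF hG
  obtain ⟨j₀, hj₀⟩ := hI'
  have : Nonempty {j // j ∉ I} := ⟨⟨j₀, hj₀⟩⟩
  -- Horns with entries in `T` have pairwise common vertices, hence lie in one of the chart domains.
  obtain ⟨T, hTo, hT, hTW⟩ := exists_isOpen_of_common_vertices (ι := {j // j ∉ I})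
    (fun p => baseInclusion X n p) (fun c x => vertexMap X n c x)
    (fun c => SmoothMfd.continuous _) (vertexMap_baseInclusion X n)
    (isOpen_iUnion fun p => isOpen_hornNhd p (φ p))
    (fun p => Set.mem_iUnion.2 ⟨p, (h p).base_mem_hornNhd⟩)
  refine ⟨⟨T, hTo⟩, ⟨⋃ p, simplexNhd X p (χ p), isOpen_iUnion fun p => isOpen_simplexNhd p (χ p)⟩,
    hT, fun p => Set.mem_iUnion.2 ⟨p, (h p).base_mem_simplexNhd⟩, fun U hU hbase hUT hUV => ?_⟩
  exact kan_of_isLocalHornChart U hU hbase hF hG h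
    (fun y hy hyc => Set.mem_iUnion.1 (hTW y (fun j => hUT (hy j))
      (exists_vertexMap_eq_of_hornCompatible X n I hI y hyc)))
    fun x hx => Set.mem_iUnion.1 (hUV hx)

/-- Neighbourhoods of the base which are contained in prescribed neighbourhoods and stable under
the face maps. -/
theorem exists_faceStable (O : ∀ n : ℕ, Opens (X _⦋n⦌)) (hO : ∀ n p, baseInclusion X n p ∈ O n) :
    ∃ U : ∀ n : ℕ, Opens (X _⦋n⦌), (∀ n, U n ≤ O n) ∧ (∀ n p, baseInclusion X n p ∈ U n) ∧
      ∀ (n : ℕ) (i : Fin (n + 2)), Set.MapsTo (X.δ i) (U (n + 1)) (U n) := by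
  -- Recursively, `U (n + 1)` consists of the points of `O (n + 1)` with all faces in `U n`.
  let U : ∀ n : ℕ, Opens (X _⦋n⦌) := fun n => Nat.rec (motive := fun n => Opens (X _⦋n⦌)) (O 0)
    (fun n V => O (n + 1) ⊓ ⨅ i, V.comap ⟨X.δ i, SmoothMfd.continuous (X.δ i)⟩) n
  have hmem : ∀ n (x : X _⦋n + 1⦌), x ∈ U (n + 1) ↔ x ∈ O (n + 1) ∧ ∀ i, X.δ i x ∈ U n := by
    intro n x
    change x ∈ O (n + 1) ∧
      x ∈ (⨅ i, (U n).comap ⟨X.δ i, SmoothMfd.continuous (X.δ i)⟩ : Opens (X _⦋n + 1⦌)) ↔ _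
    rw [← SetLike.mem_coe (p := iInf _), Opens.coe_iInf, Set.mem_iInter]
    rfl
  refine ⟨U, fun n => ?_, fun n => ?_, fun n i x hx => ((hmem n x).1 hx).2 i⟩
  · cases n with
    | zero => exact le_rfl
    | succ n => exact inf_le_left
  · induction n with
    | zero => exact hO 0
    | succ n ih =>
      intro p
      refine (hmem n _).2 ⟨hO _ p, fun i => ?_⟩
      rw [δ_baseInclusion]
      exact ih p

end Neighborhoods

end

/-! ### The theorem -/

theorem mainTheorem2 (X : SimplicialObject SmoothMfd.{u}) :
    ∃ (U : ∀ n : ℕ, Opens (X _⦋n⦌))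
      (hU : ∀ (n : ℕ) (i : Fin (n + 2)), Set.MapsTo (X.δ i) (U (n + 1)) (U n)),
      (∀ n : ℕ, Set.range (baseInclusion X n) ⊆ U n) ∧
      (SemisimplicialMfd.ofFaceStable X U hU).IsKan := by
  choose T V hT hV hK using fun (n : ℕ) (I : {I : Finset (Fin (n + 2)) // I.Nonempty ∧ ∃ j, j ∉ I})
    => exists_opens_forall_kan X n I.1 I.2.1 I.2.2
  have hmem : ∀ {n : ℕ} {ι : Type} [Finite ι] (A : ι → Opens (X _⦋n⦌)) (x : X _⦋n⦌),
      (∀ i, x ∈ A i) → x ∈ ⨅ i, A i := by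
    intro n ι _ A x hx
    rw [← SetLike.mem_coe, Opens.coe_iInf]
    exact Set.mem_iInter.2 hx
  -- The sets `V n I` live at level `n + 1`, so level `0` receives no condition from them.
  let V' : ∀ n : ℕ, Opens (X _⦋n⦌) := fun n => match n with
    | 0 => ⊤
    | n + 1 => ⨅ I, V n I
  obtain ⟨U, hUO, hbase, hU⟩ := exists_faceStable X (fun n => (⨅ I, T n I) ⊓ V' n) (fun n p => by
    refine ⟨hmem _ _ fun I => hT n I p, ?_⟩
    cases n with
    | zero => trivial
    | succ n => exact hmem _ _ fun I => hV n I p)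
  have hkan : ∀ n (I : Finset (Fin (n + 2))), I.Nonempty → (∃ j, j ∉ I) →
      (SemisimplicialMfd.ofFaceStable X U hU).Kan n I := fun n I hI hI' =>
    hK n ⟨I, hI, hI'⟩ U hU hbase (((hUO n).trans inf_le_left).trans (iInf_le _ _))
      (((hUO (n + 1)).trans inf_le_right).trans (iInf_le (V n) ⟨I, hI, hI'⟩))
  refine ⟨U, hU, fun n => ?_, fun n i => ?_, fun n m i hm hmn him => ?_⟩
  · rintro _ ⟨p, rfl⟩
    exact hbase n p
  · refine hkan n {i} ⟨i, by simp⟩ ?_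
    obtain ⟨j, hj⟩ := exists_ne i
    exact ⟨j, by simpa using hj⟩
  · refine hkan n _ ⟨i, by simp⟩ ?_
    -- An index outside the set: `1` if `i = 0`, using `1 ≤ m`, and `0` otherwise.
    by_cases hi : (i : ℕ) = 0
    · refine ⟨⟨1, by omega⟩, ?_⟩
      simp only [Finset.mem_insert, Finset.mem_filter, Finset.mem_univ, true_and, Fin.ext_iff]
      omega
    · refine ⟨⟨0, by omega⟩, ?_⟩
      simp only [Finset.mem_insert, Finset.mem_filter, Finset.mem_univ, true_and, Fin.ext_iff]
      omega
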